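/- **Notation.** Let $\mathbf x\sim\mathcal N(\mathbf 0,\mathbf I)$ in $\mathbb R^d$; for a subspace $V\subseteq\mathbb R^d$ write $\mathbf x^V$ for the orthogonal projection of $\mathbf x$ onto $V$. For Borel $A\subseteq\mathbb R^d$ let $\Gamma(A)=\liminf_{\delta\to0^+}\Pr[\mathbf x\in A_\delta\setminus A]/\delta$, where $A_\delta=\{\mathbf x:\mathrm{dist}(\mathbf x,A)\le\delta\}$. For a finite $\mathcal Y\subseteq\mathbb Z$ and $f:\mathbb R^d\to\mathcal Y$ Borel, let $\Gamma(f)=\sum_{z\in\mathcal Y}\Gamma(f^{-1}(z))$. **Definition.** A class $\mathcal F$ of Borel functions $\mathbb R^d\to\mathcal Y$ is a class of *$(m,\zeta,\alpha,K,\tau,\sigma,\Gamma)$-well-behaved multi-index models* if every $f\in\mathcal F$ satisfies $\Gamma(f)\le\Gamma$ and there is a subspace $W\subseteq\mathbb R^d$ with $\dim W\le K$ such that $f(\mathbf x)=f(\mathbf x^W)$ for all $\mathbf x\in\mathbb R^d$ and such that, for every random label $y\in\mathcal Y$ (jointly distributed with $\mathbf x$) with $\Pr[f(\mathbf x)\ne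 y]\le\zeta$ and every subspace $V\subseteq\mathbb R^d$, at least one of the following holds: (a) there is a Borel $g:V\to\mathcal Y$ with $\Pr[g(\mathbf x^V)\ne f(\mathbf x)]\le\tau$; or (b) with probability at least $\alpha$ over $\mathbf x_0\sim\mathcal N(\mathbf 0,\mathbf I)$ (independent of $\mathbf x$) there are a polynomial $p:U\to\mathbb R$ of degree at most $m$, where $U=(V+W)\cap V^\perp$, and a label $z\in\mathcal Y$ such that $\mathbb E[p(\mathbf x^U)]=0$ and $$\mathbb E\big[p(\mathbf x^U)\,\mathbf 1(y=z)\,\big|\,\mathbf x^V=\mathbf x_0^V\big]>\sigma\,\big(\mathbb E[p(\mathbf x^U)^2]\big)^{1/2}.$$ Let $\mathcal F_{K,d}$ be the class of intersections of $K$ halfspaces in $\mathbb R^d$, i.e. of the functions $f:\mathbb R^d\to\{0,1\}$, $f(\mathbf x)=\prod_{i=1}^K\mathbf 1(\mathbf w^{(i)}\cdot\mathbf x+t_i\ge0)$ with $\mathbf w^{(i)}\in\mathbb R^d$, $t_i\in\mathbb R$. **Proposition 4.2.** There are universal constants $C>0$, $c\in(0,1)$ and $q\in\mathbb N$ such that for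 all integers $d,K\ge1$ and all $\zeta,\epsilon\in(0,1)$, the class $\mathcal F_{K,d}$ (with $\mathcal Y=\{0,1\}$) is a class of $$\Big(2,\ \zeta,\ \epsilon,\ K,\ C K\,\zeta\log(1/\zeta+1)+\epsilon,\ c\,(\epsilon/K)^q,\ C\sqrt{\log(K+1)}\Big)\text{-well-behaved}$$ multi-index models. (If $\tau=CK\zeta\log(1/\zeta+1)+\epsilon\ge1$, alternative (a) holds trivially.) -/

import Mathlib

open MeasureTheory ProbabilityTheory Filter Topology
open scoped InnerProductSpace

noncomputable section

/-- The space `ℝ^d` with its Euclidean structure. -/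
abbrev RSpace (d : ℕ) : Type := EuclideanSpace ℝ (Fin d)

/-- Gaussian surface area of a set `A ⊆ ℝ^d`:
`liminf_{δ → 0+} Pr_{x ∼ N(0, I)}[x ∈ A_δ \ A] / δ`, where `A_δ = {x : dist(x, A) ≤ δ}`
(which is empty when `A` is empty). -/
def gaussianSurfaceArea {d : ℕ} (A : Set (RSpace d)) : ENNReal :=
  liminf (fun δ : ℝ => stdGaussian (RSpace d) (Metric.cthickening δ A \ A) / ENNReal.ofReal δ)
    (𝓝[>] (0 : ℝ))

/-- Gaussian surface area of a multiclass function with labels in `𝒴`: the sum of the Gaussian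
surface areas of its label sets. -/
def multiclassSurfaceArea {d : ℕ} (𝒴 : Finset ℤ) (f : RSpace d → ℤ) : ENNReal :=
  ∑ z ∈ 𝒴, gaussianSurfaceArea {x | f x = z}

/-- `p : U → ℝ` is a polynomial of degree at most `m` on the subspace `U ⊆ ℝ^d`. Polynomials on `U`
are exactly the restrictions to `U` of polynomials of the same degree in the coordinates
of `ℝ^d`. -/
def IsPolynomialOn {d : ℕ} (U : Submodule ℝ (RSpace d)) (m : ℕ) (p : U → ℝ) : Prop :=
  ∃ q : MvPolynomial (Fin d) ℝ, q.totalDegree ≤ m ∧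
    ∀ u : U, p u = MvPolynomial.eval (fun i => (u : RSpace d) i) q

/-- The joint distribution `D` of a pair `(x, y)` with `x ∼ N(0, I)` in `ℝ^d` and with `y` a random
label supported on `𝒴`. -/
structure IsLabeledGaussian {d : ℕ} (𝒴 : Finset ℤ) (D : Measure (RSpace d × ℤ)) : Prop where
  marginal : D.map Prod.fst = stdGaussian (RSpace d)
  label_mem : ∀ᵐ ω ∂D, ω.2 ∈ 𝒴

/-- The regular conditional distribution of `(x, y) ∼ D` given the projection `x^V`, as a kernel
from `V`. -/
def condOnProj {d : ℕ} (D : Measure (RSpace d × ℤ)) [IsProbabilityMeasure D]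
    (V : Submodule ℝ (RSpace d)) : Kernel V (RSpace d × ℤ) :=
  condDistrib (fun ω : RSpace d × ℤ => ω)
    (fun ω : RSpace d × ℤ => V.orthogonalProjectionOnto ω.1) D

/-- At the point `x₀` there is a polynomial `p : U → ℝ` of degree at most `m`, with `p(x^U)` of mean
zero, and a label `z ∈ 𝒴` such that
`E[p(x^U) 1(y = z) | x^V = x₀^V] > σ ‖p(x^U)‖₂`. -/
def HasMoment {d : ℕ} (𝒴 : Finset ℤ) (m : ℕ) (σ : ℝ) (D : Measure (RSpace d × ℤ))
    [IsProbabilityMeasure D] (V U : Submodule ℝ (RSpace d)) (x₀ : RSpace d) : Prop :=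
  ∃ p : U → ℝ, IsPolynomialOn U m p ∧ ∃ z ∈ 𝒴,
    ∫ x, p (U.orthogonalProjectionOnto x) ∂(stdGaussian (RSpace d)) = 0 ∧
    σ * √(∫ x, p (U.orthogonalProjectionOnto x) ^ 2 ∂(stdGaussian (RSpace d))) <
      ∫ ω, p (U.orthogonalProjectionOnto ω.1) * Set.indicator {k : ℤ | k = z} (fun _ => (1 : ℝ)) ω.2
        ∂(condOnProj D V (V.orthogonalProjectionOnto x₀))

/-- A class `F` of (Borel) functions `ℝ^d → 𝒴` is a class of
`(m, ζ, α, K, τ, σ, Γ)`-well-behaved multi-index models. -/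
def IsWellBehaved {d : ℕ} (𝒴 : Finset ℤ) (F : Set (RSpace d → ℤ))
    (m : ℕ) (ζ α : ℝ) (K : ℕ) (τ σ Γ : ℝ) : Prop :=
  ∀ f ∈ F, Measurable f ∧ (∀ x, f x ∈ 𝒴) ∧
    multiclassSurfaceArea 𝒴 f ≤ ENNReal.ofReal Γ ∧
    ∃ W : Submodule ℝ (RSpace d), Module.finrank ℝ W ≤ K ∧
      (∀ x, f x = f (W.orthogonalProjectionOnto x)) ∧
      ∀ (D : Measure (RSpace d × ℤ)) [IsProbabilityMeasure D], IsLabeledGaussian 𝒴 D →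
        D {ω | f ω.1 ≠ ω.2} ≤ ENNReal.ofReal ζ →
        ∀ V : Submodule ℝ (RSpace d),
          (∃ g : V → ℤ, Measurable g ∧ (∀ v, g v ∈ 𝒴) ∧
            stdGaussian (RSpace d) {x | g (V.orthogonalProjectionOnto x) ≠ f x} ≤ ENNReal.ofReal τ) ∨
          ENNReal.ofReal α ≤
            stdGaussian (RSpace d) {x₀ | HasMoment 𝒴 m σ D V ((V ⊔ W) ⊓ Vᗮ) x₀}

/-- The class of intersections of `K` halfspaces of `ℝ^d`: the functions
`f(x) = ∏_{i ≤ K} 1(w⁽ⁱ⁾ · x + t_i ≥ 0)`. -/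
def intersectionsOfHalfspaces (K d : ℕ) : Set (RSpace d → ℤ) :=
  {f | ∃ (w : Fin K → RSpace d) (t : Fin K → ℝ),
    f = Set.indicator {x | ∀ i, 0 ≤ ⟪w i, x⟫_ℝ + t i} (fun _ => (1 : ℤ))}

end

/-!
Condition on `x^V`: on a fibre the standard Gaussian is the Gaussian of `Vᗮ` and the intersection of
halfspaces is again a polyhedron. Predict by majority vote on each fibre. If this errs on more than
`τ`, then on a set of fibres of probability at least `ε` the minority class has mass bounded below
while the label noise is small relative to that mass.

On such a fibre, consider the facet with the most likely complement. Write `n` for its unit normal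
and `s` for the coordinate along `n`. The polyhedron has no mass beyond the facet, and the mass of
its slices is log-concave in `s` by the Prékopa–Leindler inequality, so under the Gaussian
restricted to the polyhedron either the mean of `s` is visibly nonzero or its variance is visibly
smaller than `1`. Hence `s` or `1 - s²` correlates with the indicator of the polyhedron, and the
exponential moments of `s` bound what the noise can do to that correlation.

The bound on the surface area is Nazarov's: the shell around the polyhedron is split according to
the most violated constraint.
-/

section PrekopaLeindler

open scoped Pointwise

theorem volume_add_volume_le_volume_add_of_isCompact {S T : Set ℝ} (hS : IsCompact S)
    (hT : IsCompact T) (hS₀ : S.Nonempty) (hT₀ : T.Nonempty) :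
    volume S + volume T ≤ volume (S + T) := by
  obtain ⟨x, hx, hxS⟩ := hS.exists_isGreatest hS₀
  obtain ⟨y, hy, hyT⟩ := hT.exists_isLeast hT₀
  -- `S + y` and `x + T` lie in `S + T` on either side of their common point `x + y`.
  have left : (· + y) '' S ⊆ (S + T) ∩ Set.Iic (x + y) := by
    rintro _ ⟨s, hs, rfl⟩
    exact ⟨Set.add_mem_add hs hy, add_le_add_left (hxS hs) y⟩
  have right : (x + ·) '' T ⊆ (S + T) ∩ Set.Ici (x + y) := by
    rintro _ ⟨t, ht, rfl⟩
    exact ⟨Set.add_mem_add hx ht, add_le_add_right (hyT ht) x⟩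
  calc volume S + volume T = volume ((· + y) '' S) + volume ((x + ·) '' T) := by
        rw [Set.image_add_right, measure_preimage_add_right, Set.image_add_left,
          measure_preimage_add]
    _ ≤ volume ((S + T) ∩ Set.Iic (x + y)) + volume ((S + T) ∩ Set.Ici (x + y)) :=
        add_le_add (measure_mono left) (measure_mono right)
    _ = volume ((S + T) ∩ Set.Iic (x + y)) + volume ((S + T) \ Set.Iic (x + y)) := by
        rw [Set.sdiff_eq_compl_inter, Set.compl_Iic, Set.inter_comm _ (S + T),
          measure_congr ((ae_eq_refl (S + T)).inter Ioi_ae_eq_Ici)]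
    _ = volume (S + T) := measure_inter_add_sdiff _ measurableSet_Iic

theorem volume_add_volume_le_volume_add {S T : Set ℝ} (hS : MeasurableSet S)
    (hT : MeasurableSet T) (hS₀ : S.Nonempty) (hT₀ : T.Nonempty) :
    volume S + volume T ≤ volume (S + T) := by
  obtain ⟨x, hx⟩ := hS₀
  obtain ⟨y, hy⟩ := hT₀
  rw [hS.measure_eq_iSup_isCompact, hT.measure_eq_iSup_isCompact]
  simp only [iSup_and']
  refine ENNReal.biSup_add_biSup_le' ⟨∅, by simp⟩ ⟨∅, by simp⟩ fun A hA B hB ↦ ?_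
  calc volume A + volume B ≤ volume (insert x A) + volume (insert y B) :=
        add_le_add (measure_mono (Set.subset_insert _ _)) (measure_mono (Set.subset_insert _ _))
    _ ≤ volume (insert x A + insert y B) :=
        volume_add_volume_le_volume_add_of_isCompact (hA.2.insert x) (hB.2.insert y)
          (Set.insert_nonempty _ _) (Set.insert_nonempty _ _)
    _ ≤ volume (S + T) := measure_mono
        (Set.add_subset_add (Set.insert_subset hx hA.1) (Set.insert_subset hy hB.1))

theorem mul_volume_add_mul_volume_le {S T R : Set ℝ} (hS : MeasurableSet S)
    (hT : MeasurableSet T) (hS₀ : S.Nonempty) (hT₀ : T.Nonempty) {a b : ℝ} (ha : 0 < a)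
    (hb : 0 < b) (hR : ∀ x ∈ S, ∀ y ∈ T, a * x + b * y ∈ R) :
    ENNReal.ofReal a * volume S + ENNReal.ofReal b * volume T ≤ volume R := by
  have volume_smul : ∀ {c : ℝ}, 0 < c → ∀ A : Set ℝ,
      ENNReal.ofReal c * volume A = volume (c • A) := fun hc A ↦ by
    rw [Measure.addHaar_smul, Module.finrank_self, pow_one, abs_of_pos hc]
  rw [volume_smul ha, volume_smul hb]
  refine (volume_add_volume_le_volume_add (hS.const_smul₀ a) (hT.const_smul₀ b) hS₀.smul_set
    hT₀.smul_set).trans (measure_mono ?_)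
  rintro _ ⟨_, ⟨x, hx, rfl⟩, _, ⟨y, hy, rfl⟩, rfl⟩
  exact hR x hx y hy

variable {u v w : ℝ → ℝ} {a b : ℝ}

theorem mul_volume_superlevel_add_le (hu : Measurable u) (hv : Measurable v) (ha : 0 < a)
    (hb : 0 < b) (hab : a + b = 1) (u_lub : IsLUB (Set.range u) 1) (v_lub : IsLUB (Set.range v) 1)
    (h : ∀ x y, u x ^ a * v y ^ b ≤ w (a * x + b * y)) {t : ℝ} (ht : 0 < t) :
    ENNReal.ofReal a * volume {x | t < u x} + ENNReal.ofReal b * volume {x | t < v x} ≤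
      volume {x | t < w x} := by
  rcases lt_or_ge t 1 with ht1 | ht1
  · have nonempty : ∀ {g : ℝ → ℝ}, IsLUB (Set.range g) 1 → {x | t < g x}.Nonempty := fun hg ↦ by
      obtain ⟨_, ⟨x, rfl⟩, hx, -⟩ := hg.exists_between ht1
      exact ⟨x, hx⟩
    refine mul_volume_add_mul_volume_le (measurableSet_lt measurable_const hu)
      (measurableSet_lt measurable_const hv) (nonempty u_lub) (nonempty v_lub) ha hb
      fun x hx y hy ↦ ?_
    calc t = t ^ a * t ^ b := by rw [← Real.rpow_add ht, hab, Real.rpow_one]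
      _ < u x ^ a * v y ^ b := mul_lt_mul'' (Real.rpow_lt_rpow ht.le hx ha)
          (Real.rpow_lt_rpow ht.le hy hb) (by positivity) (by positivity)
      _ ≤ w (a * x + b * y) := h x y
  · have empty : ∀ {g : ℝ → ℝ}, IsLUB (Set.range g) 1 → {x | t < g x} = ∅ := fun hg ↦
      Set.eq_empty_of_forall_notMem fun x hx ↦ (hg.1 ⟨x, rfl⟩).not_gt (ht1.trans_lt hx)
    simp [empty u_lub, empty v_lub]

theorem mul_integral_add_mul_integral_le_of_isLUB (hu : Measurable u) (hv : Measurable v)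
    (u0 : 0 ≤ u) (v0 : 0 ≤ v) (w0 : 0 ≤ w) (iu : Integrable u) (iv : Integrable v)
    (iw : Integrable w) (ha : 0 < a) (hb : 0 < b) (hab : a + b = 1)
    (u_lub : IsLUB (Set.range u) 1) (v_lub : IsLUB (Set.range v) 1)
    (h : ∀ x y, u x ^ a * v y ^ b ≤ w (a * x + b * y)) :
    a * (∫ x, u x) + b * (∫ x, v x) ≤ ∫ x, w x := by
  have measurable_superlevel : ∀ g : ℝ → ℝ, Measurable fun t : ℝ ↦ volume {x | t < g x} :=
    fun g ↦ Antitone.measurable fun s t hst ↦ measure_mono fun x (hx : t < g x) ↦ hst.trans_lt hx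
  have layer_cake : ENNReal.ofReal a * (∫⁻ x, ENNReal.ofReal (u x)) +
      ENNReal.ofReal b * (∫⁻ x, ENNReal.ofReal (v x)) ≤ ∫⁻ x, ENNReal.ofReal (w x) := by
    rw [lintegral_eq_lintegral_meas_lt volume (ae_of_all _ u0) hu.aemeasurable,
      lintegral_eq_lintegral_meas_lt volume (ae_of_all _ v0) hv.aemeasurable,
      lintegral_eq_lintegral_meas_lt volume (ae_of_all _ w0) iw.aemeasurable,
      ← lintegral_const_mul _ (measurable_superlevel _),
      ← lintegral_const_mul _ (measurable_superlevel _),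
      ← lintegral_add_left ((measurable_superlevel _).const_mul _)]
    exact setLIntegral_mono' measurableSet_Ioi fun t ht ↦
      mul_volume_superlevel_add_le hu hv ha hb hab u_lub v_lub h ht
  have ui : 0 ≤ ∫ x, u x := integral_nonneg u0
  have vi : 0 ≤ ∫ x, v x := integral_nonneg v0
  rwa [← ofReal_integral_eq_lintegral_ofReal iu (ae_of_all _ u0),
    ← ofReal_integral_eq_lintegral_ofReal iv (ae_of_all _ v0),
    ← ofReal_integral_eq_lintegral_ofReal iw (ae_of_all _ w0), ← ENNReal.ofReal_mul ha.le,
    ← ENNReal.ofReal_mul hb.le, ← ENNReal.ofReal_add (by positivity) (by positivity),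
    ENNReal.ofReal_le_ofReal_iff (integral_nonneg w0)] at layer_cake

theorem exists_pos_isLUB_range_div (u0 : 0 ≤ u) (bu : BddAbove (Set.range u))
    (hu : 0 < ∫ x, u x) : ∃ M, 0 < M ∧ IsLUB (Set.range fun x ↦ u x / M) 1 := by
  set M := sSup (Set.range u)
  have hM : IsLUB (Set.range u) M := isLUB_csSup (Set.range_nonempty u) bu
  have M_pos : 0 < M := by
    by_contra! M_le
    have : u = 0 := funext fun x ↦ le_antisymm ((hM.1 ⟨x, rfl⟩).trans M_le) (u0 x)
    simp [this] at hu
  refine ⟨M, M_pos, ?_, fun c hc ↦ ?_⟩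
  · rintro _ ⟨x, rfl⟩
    exact (div_le_one M_pos).2 (hM.1 ⟨x, rfl⟩)
  · rw [← mul_le_mul_iff_left₀ M_pos, one_mul]
    refine hM.2 ?_
    rintro _ ⟨x, rfl⟩
    exact (div_le_iff₀ M_pos).1 (hc ⟨x, rfl⟩)

theorem prekopaLeindler_real (hu : Measurable u) (hv : Measurable v) (u0 : 0 ≤ u) (v0 : 0 ≤ v)
    (w0 : 0 ≤ w) (bu : BddAbove (Set.range u)) (bv : BddAbove (Set.range v))
    (iu : Integrable u) (iv : Integrable v) (iw : Integrable w)
    (ha : 0 < a) (hb : 0 < b) (hab : a + b = 1)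
    (h : ∀ x y, u x ^ a * v y ^ b ≤ w (a * x + b * y)) :
    (∫ x, u x) ^ a * (∫ x, v x) ^ b ≤ ∫ x, w x := by
  have wi : 0 ≤ ∫ x, w x := integral_nonneg w0
  rcases (integral_nonneg u0).eq_or_lt with hu0 | ui
  · rwa [← hu0, Real.zero_rpow ha.ne', zero_mul]
  rcases (integral_nonneg v0).eq_or_lt with hv0 | vi
  · rwa [← hv0, Real.zero_rpow hb.ne', mul_zero]
  obtain ⟨M, hM, u_lub⟩ := exists_pos_isLUB_range_div u0 bu ui
  obtain ⟨N, hN, v_lub⟩ := exists_pos_isLUB_range_div v0 bv vi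
  have rpow_div : ∀ {s t}, 0 ≤ s → 0 ≤ t →
      (s / M) ^ a * (t / N) ^ b = s ^ a * t ^ b / (M ^ a * N ^ b) := fun hs ht ↦ by
    rw [Real.div_rpow hs hM.le, Real.div_rpow ht hN.le, div_mul_div_comm]
  have normalized : a * (∫ x, u x / M) + b * (∫ x, v x / N) ≤ ∫ x, w x / (M ^ a * N ^ b) := by
    refine mul_integral_add_mul_integral_le_of_isLUB (hu.div_const M) (hv.div_const N)
      (fun x ↦ div_nonneg (u0 x) hM.le) (fun x ↦ div_nonneg (v0 x) hN.le)
      (fun x ↦ div_nonneg (w0 x) (by positivity)) (iu.div_const M) (iv.div_const N)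
      (iw.div_const _) ha hb hab u_lub v_lub fun x y ↦ ?_
    rw [rpow_div (u0 x) (v0 y)]
    exact div_le_div_of_nonneg_right (h x y) (by positivity)
  simp only [integral_div] at normalized
  rw [← div_le_div_iff_of_pos_right (by positivity : 0 < M ^ a * N ^ b), ← rpow_div ui.le vi.le]
  exact (Real.geom_mean_le_arith_mean2_weighted ha.le hb.le (by positivity) (by positivity)
    hab).trans normalized

end PrekopaLeindler

section LogConcave

variable {E E' : Type*} [AddCommGroup E] [Module ℝ E] [AddCommGroup E'] [Module ℝ E']

/-- Log-concavity of a nonnegative function `F` on a real vector space, in multiplicative form so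
that `F` may vanish. -/
structure IsLogConcave (F : E → ℝ) : Prop where
  nonneg : 0 ≤ F
  rpow_mul_rpow_le : ∀ x y (a b : ℝ), 0 < a → 0 < b → a + b = 1 →
    F x ^ a * F y ^ b ≤ F (a • x + b • y)

namespace IsLogConcave

variable {F G : E → ℝ}

theorem comp_affineMap (hF : IsLogConcave F) (g : E' →ᵃ[ℝ] E) : IsLogConcave fun x ↦ F (g x) where
  nonneg x := hF.nonneg _
  rpow_mul_rpow_le x y a b ha hb hab := by
    rw [Convex.combo_affine_apply hab]
    exact hF.rpow_mul_rpow_le _ _ a b ha hb hab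

theorem mul (hF : IsLogConcave F) (hG : IsLogConcave G) : IsLogConcave fun x ↦ F x * G x where
  nonneg x := mul_nonneg (hF.nonneg x) (hG.nonneg x)
  rpow_mul_rpow_le x y a b ha hb hab := by
    rw [Real.mul_rpow (hF.nonneg x) (hG.nonneg x), Real.mul_rpow (hF.nonneg y) (hG.nonneg y),
      mul_mul_mul_comm]
    exact mul_le_mul (hF.rpow_mul_rpow_le x y a b ha hb hab)
      (hG.rpow_mul_rpow_le x y a b ha hb hab)
      (mul_nonneg (Real.rpow_nonneg (hG.nonneg x) a) (Real.rpow_nonneg (hG.nonneg y) b))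
      (hF.nonneg _)

theorem exp {V : E → ℝ} (hV : ConcaveOn ℝ Set.univ V) : IsLogConcave fun x ↦ Real.exp (V x) where
  nonneg x := (Real.exp_pos _).le
  rpow_mul_rpow_le x y a b ha hb hab := by
    rw [← Real.exp_mul, ← Real.exp_mul, ← Real.exp_add, Real.exp_le_exp, mul_comm, mul_comm (V y)]
    exact hV.2 (Set.mem_univ x) (Set.mem_univ y) ha.le hb.le hab

theorem indicator_one {A : Set E} (hA : Convex ℝ A) : IsLogConcave (A.indicator (1 : E → ℝ)) where
  nonneg x := Set.indicator_nonneg (fun _ _ ↦ zero_le_one) _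
  rpow_mul_rpow_le x y a b ha hb hab := by
    have nonneg : 0 ≤ A.indicator (1 : E → ℝ) (a • x + b • y) :=
      Set.indicator_nonneg (fun _ _ ↦ zero_le_one) _
    by_cases hx : x ∈ A
    · by_cases hy : y ∈ A
      · simp [hx, hy, hA hx hy ha.le hb.le hab]
      · simpa [hy, Real.zero_rpow hb.ne'] using nonneg
    · simpa [hx, Real.zero_rpow ha.ne'] using nonneg

theorem ordConnected_superlevel {q : ℝ → ℝ} (hq : IsLogConcave q) :
    Set.OrdConnected {s | 1 ≤ q s} := by
  refine Convex.ordConnected (convex_iff_forall_pos.2 fun x hx y hy a b ha hb hab ↦ ?_)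
  calc (1 : ℝ) ≤ q x ^ a * q y ^ b :=
        one_le_mul_of_one_le_of_one_le (Real.one_le_rpow hx ha.le) (Real.one_le_rpow hy hb.le)
    _ ≤ q (a • x + b • y) := hq.rpow_mul_rpow_le x y a b ha hb hab

end IsLogConcave

theorem gaussianPDFReal_zero_one (x : ℝ) :
    gaussianPDFReal 0 1 x = (√(2 * Real.pi))⁻¹ * Real.exp (-x ^ 2 / 2) := by
  simp [gaussianPDFReal]

theorem isLogConcave_gaussianPDFReal : IsLogConcave (gaussianPDFReal 0 1) := by
  have eq_exp : gaussianPDFReal 0 1 =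
      fun x ↦ Real.exp (-(1 / 2) * x ^ 2 + -Real.log (√(2 * Real.pi))) := by
    ext x
    rw [gaussianPDFReal_zero_one, Real.exp_add, Real.exp_neg, Real.exp_log (by positivity)]
    ring_nf
  rw [eq_exp]
  refine .exp (ConcaveOn.add_const ?_ _)
  simp only [neg_mul]
  exact ((even_two.convexOn_pow (𝕜 := ℝ)).smul (by norm_num : (0 : ℝ) ≤ 1 / 2)).neg

theorem gaussianPDFReal_le (x : ℝ) : gaussianPDFReal 0 1 x ≤ (√(2 * Real.pi))⁻¹ := by
  rw [gaussianPDFReal_zero_one]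
  exact mul_le_of_le_one_right (by positivity) (Real.exp_le_one_iff.2 (by nlinarith [sq_nonneg x]))

namespace IsLogConcave

theorem integral_gaussianReal {F : E × ℝ → ℝ} (hF : IsLogConcave F) (h1 : F ≤ 1)
    (hm : ∀ e, Measurable fun x ↦ F (e, x)) :
    IsLogConcave fun e ↦ ∫ x, F (e, x) ∂(gaussianReal 0 1) := by
  have hFpdf : IsLogConcave fun z : E × ℝ ↦ F z * gaussianPDFReal 0 1 z.2 :=
    hF.mul (isLogConcave_gaussianPDFReal.comp_affineMap (LinearMap.snd ℝ E ℝ).toAffineMap)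
  have le_pdf : ∀ e x, F (e, x) * gaussianPDFReal 0 1 x ≤ gaussianPDFReal 0 1 x := fun e x ↦
    mul_le_of_le_one_left (gaussianPDFReal_nonneg 0 1 x) (h1 _)
  have measurable_Fpdf : ∀ e, Measurable fun x ↦ F (e, x) * gaussianPDFReal 0 1 x := fun e ↦
    (hm e).mul (measurable_gaussianPDFReal 0 1)
  have integrable_Fpdf : ∀ e, Integrable fun x ↦ F (e, x) * gaussianPDFReal 0 1 x := fun e ↦
    (integrable_gaussianPDFReal 0 1).mono' (measurable_Fpdf e).aestronglyMeasurable
      (ae_of_all _ fun x ↦ by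
        rw [Real.norm_of_nonneg (hFpdf.nonneg (e, x))]
        exact le_pdf e x)
  have bddAbove_Fpdf : ∀ e, BddAbove (Set.range fun x ↦ F (e, x) * gaussianPDFReal 0 1 x) :=
    fun e ↦ ⟨_, Set.forall_mem_range.2 fun x ↦ (le_pdf e x).trans (gaussianPDFReal_le x)⟩
  refine ⟨fun e ↦ integral_nonneg fun x ↦ hF.nonneg _, fun e₁ e₂ a b ha hb hab ↦ ?_⟩
  simp only [integral_gaussianReal_eq_integral_smul one_ne_zero, smul_eq_mul,
    mul_comm (gaussianPDFReal 0 1 _)]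
  exact prekopaLeindler_real (measurable_Fpdf e₁) (measurable_Fpdf e₂)
    (fun x ↦ hFpdf.nonneg (e₁, x)) (fun x ↦ hFpdf.nonneg (e₂, x))
    (fun x ↦ hFpdf.nonneg (_, x)) (bddAbove_Fpdf e₁) (bddAbove_Fpdf e₂) (integrable_Fpdf _)
    (integrable_Fpdf _) (integrable_Fpdf _) ha hb hab
    fun x y ↦ hFpdf.rpow_mul_rpow_le (e₁, x) (e₂, y) a b ha hb hab

theorem integral_pi_gaussianReal {n : ℕ} {F : E × (Fin n → ℝ) → ℝ} (hF : IsLogConcave F)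
    (h1 : F ≤ 1) (hm : ∀ e, Measurable fun x ↦ F (e, x)) :
    IsLogConcave fun e ↦ ∫ x, F (e, x) ∂(Measure.pi fun _ : Fin n ↦ gaussianReal 0 1) := by
  induction n generalizing E with
  | zero =>
    simp only [Measure.pi_of_empty (fun _ : Fin 0 ↦ gaussianReal 0 1) 0, integral_dirac]
    exact hF.comp_affineMap (LinearMap.inl ℝ E (Fin 0 → ℝ)).toAffineMap
  | succ n ih =>
    let μ : Measure (Fin n → ℝ) := Measure.pi fun _ ↦ gaussianReal 0 1
    have measurable_cons : Measurable fun p : ℝ × (Fin n → ℝ) ↦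
        (Fin.cons p.1 p.2 : Fin (n + 1) → ℝ) := by fun_prop
    have fubini : ∀ e, ∫ x, F (e, x) ∂(Measure.pi fun _ : Fin (n + 1) ↦ gaussianReal 0 1) =
        ∫ t, ∫ x, F (e, Fin.cons t x) ∂μ ∂(gaussianReal 0 1) := fun e ↦ by
      rw [← (measurePreserving_piFinSuccAbove (fun _ ↦ gaussianReal 0 1) 0).symm.integral_comp'
        (g := fun x ↦ F (e, x)), integral_prod]
      · simp [μ, MeasurableEquiv.piFinSuccAbove, Fin.insertNthEquiv]
      · exact .of_bound ((hm e).comp (MeasurableEquiv.measurable _)).aestronglyMeasurable 1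
          (ae_of_all _ fun x ↦ (Real.norm_of_nonneg (hF.nonneg _)).trans_le (h1 _))
    simp only [fubini]
    let shift : (E × ℝ) × (Fin n → ℝ) →ₗ[ℝ] E × (Fin (n + 1) → ℝ) :=
      (LinearMap.id.prodMap (Fin.consLinearEquiv ℝ fun _ ↦ ℝ).toLinearMap) ∘ₗ
        (LinearEquiv.prodAssoc ℝ E ℝ (Fin n → ℝ)).toLinearMap
    have inner_logConcave : IsLogConcave fun z : E × ℝ ↦ ∫ x, F (z.1, Fin.cons z.2 x) ∂μ :=
      ih (F := fun z ↦ F (shift z)) (hF.comp_affineMap shift.toAffineMap) (fun z ↦ h1 _)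
        fun z ↦ (hm z.1).comp (measurable_cons.comp (measurable_prodMk_left (x := z.2)))
    refine inner_logConcave.integral_gaussianReal (fun z ↦ ?_) fun e ↦ ?_
    · calc ∫ x, F (z.1, Fin.cons z.2 x) ∂μ ≤ ∫ _, (1 : ℝ) ∂μ :=
            integral_mono_of_nonneg (ae_of_all _ fun x ↦ hF.nonneg _) (integrable_const 1)
              (ae_of_all _ fun x ↦ h1 _)
        _ = 1 := by simp [μ]
    · exact (StronglyMeasurable.integral_prod_right
        (f := fun (t : ℝ) (x : Fin n → ℝ) ↦ F (e, Fin.cons t x))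
        ((hm e).comp measurable_cons).stronglyMeasurable).measurable

theorem integral_stdGaussian {H : Type*} [NormedAddCommGroup H] [InnerProductSpace ℝ H]
    [FiniteDimensional ℝ H] [MeasurableSpace H] [BorelSpace H] {F : E × H → ℝ}
    (hF : IsLogConcave F) (h1 : F ≤ 1) (hm : ∀ e, Measurable fun x ↦ F (e, x)) :
    IsLogConcave fun e ↦ ∫ x, F (e, x) ∂(stdGaussian H) := by
  let coords : (Fin (Module.finrank ℝ H) → ℝ) →ₗ[ℝ] H :=
    Fintype.linearCombination ℝ (stdOrthonormalBasis ℝ H)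
  have measurable_coords : Measurable coords := coords.continuous_of_finiteDimensional.measurable
  have eq_pi : ∀ e, ∫ x, F (e, x) ∂(stdGaussian H) =
      ∫ y, F (e, coords y) ∂(Measure.pi fun _ ↦ gaussianReal 0 1) := fun e ↦
    integral_map measurable_coords.aemeasurable (hm e).aestronglyMeasurable
  simp only [eq_pi]
  exact (hF.comp_affineMap (LinearMap.id.prodMap coords).toAffineMap).integral_pi_gaussianReal
    (fun z ↦ h1 _) fun e ↦ (hm e).comp measurable_coords

end IsLogConcave

end LogConcave

section Gaussian

theorem integrable_pow_gaussianReal (n : ℕ) : Integrable (fun s : ℝ ↦ s ^ n) (gaussianReal 0 1) :=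
  (memLp_id_gaussianReal (μ := 0) (v := 1) n).integrable_norm_pow'.mono' (by fun_prop)
    (ae_of_all _ fun x ↦ by simp)

theorem integrable_id_gaussianReal : Integrable (fun s : ℝ ↦ s) (gaussianReal 0 1) := by
  simpa using integrable_pow_gaussianReal 1

theorem integral_sq_gaussianReal : ∫ s, s ^ 2 ∂(gaussianReal 0 1) = 1 := by
  have variance_id := variance_id_gaussianReal (μ := 0) (v := 1)
  rw [variance_of_integral_eq_zero (by fun_prop) (by simp)] at variance_id
  simpa using variance_id

theorem integral_pow_four_gaussianReal : ∫ s, s ^ 4 ∂(gaussianReal 0 1) = 3 := by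
  have half_line : ∫ s in Set.Ioi (0 : ℝ), s ^ 4 * Real.exp (-s ^ 2 / 2) =
      3 / 2 * √(2 * Real.pi) := by
    have gamma := integral_rpow_mul_exp_neg_mul_rpow (p := 2) (q := 4) (b := 1 / 2)
      (by norm_num) (by norm_num) (by norm_num)
    have gamma_five_halves : Real.Gamma ((4 + 1) / 2) = 3 * √Real.pi / 4 := by
      have := Real.Gamma_nat_add_half 2
      norm_num [Nat.doubleFactorial] at this ⊢
      exact this
    have rpow_five_halves : ((1 : ℝ) / 2) ^ (-(4 + 1) / 2 : ℝ) = 4 * √2 := by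
      rw [one_div, Real.inv_rpow zero_le_two, ← Real.rpow_neg zero_le_two,
        show -(-(4 + 1) / 2 : ℝ) = 2 + 1 / 2 by norm_num, Real.rpow_add two_pos,
        ← Real.sqrt_eq_rpow]
      norm_num
    rw [gamma_five_halves, rpow_five_halves] at gamma
    rw [Real.sqrt_mul zero_le_two, show 3 / 2 * (√2 * √Real.pi) =
      4 * √2 * (1 / 2) * (3 * √Real.pi / 4) by ring, ← gamma]
    congr 1 with s
    norm_cast
    ring_nf
  rw [integral_gaussianReal_eq_integral_smul one_ne_zero]
  have even : (fun s : ℝ ↦ gaussianPDFReal 0 1 s • s ^ 4) =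
      fun s ↦ (√(2 * Real.pi))⁻¹ * (|s| ^ 4 * Real.exp (-|s| ^ 2 / 2)) := by
    ext s
    rw [gaussianPDFReal_zero_one, sq_abs, Even.pow_abs (by decide), smul_eq_mul]
    ring
  rw [even, integral_const_mul, integral_comp_abs (f := fun s ↦ s ^ 4 * Real.exp (-s ^ 2 / 2)),
    half_line]
  field_simp

theorem integral_exp_sq_div_four_gaussianReal :
    ∫ s : ℝ, Real.exp (s ^ 2 / 4) ∂(gaussianReal 0 1) = √2 := by
  have density (s : ℝ) : gaussianPDFReal 0 1 s • Real.exp (s ^ 2 / 4) =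
      (√(2 * Real.pi))⁻¹ * Real.exp (-(1 / 4) * s ^ 2) := by
    rw [gaussianPDFReal_zero_one, smul_eq_mul, mul_assoc, ← Real.exp_add]
    ring_nf
  rw [integral_gaussianReal_eq_integral_smul one_ne_zero]
  simp only [density]
  rw [integral_const_mul, integral_gaussian, inv_mul_eq_div, ← Real.sqrt_div' _ (by positivity)]
  congr 1
  field_simp
  norm_num

theorem integrable_exp_sq_div_four_gaussianReal :
    Integrable (fun s : ℝ ↦ Real.exp (s ^ 2 / 4)) (gaussianReal 0 1) :=
  Integrable.of_integral_ne_zero (by rw [integral_exp_sq_div_four_gaussianReal]; positivity)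

theorem measureReal_gaussianReal_pos {U : Set ℝ} (hU : IsOpen U) (hn : U.Nonempty) :
    0 < (gaussianReal 0 1).real U :=
  ENNReal.toReal_pos
    (fun h ↦ (hU.measure_pos volume hn).ne' (gaussianReal_absolutelyContinuous' 0 one_ne_zero h))
    (measure_ne_top _ _)

theorem integrable_gaussianReal_iff {g : ℝ → ℝ} :
    Integrable g (gaussianReal 0 1) ↔ Integrable fun x ↦ g x * gaussianPDFReal 0 1 x := by
  rw [gaussianReal_of_var_ne_zero _ one_ne_zero,
    integrable_withDensity_iff (measurable_gaussianPDF 0 1)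
      (ae_of_all _ fun x ↦ gaussianPDF_lt_top)]
  simp

theorem gaussianPDFReal_zero_one_add (s a : ℝ) :
    gaussianPDFReal 0 1 (s + a) = Real.exp (-a * s - a ^ 2 / 2) * gaussianPDFReal 0 1 s := by
  rw [gaussianPDFReal_zero_one, gaussianPDFReal_zero_one, mul_left_comm, ← Real.exp_add]
  congr 2; ring

theorem integral_comp_add_mul_exp_gaussianReal (g : ℝ → ℝ) (a : ℝ) :
    ∫ s, g (s + a) * Real.exp (-a * s - a ^ 2 / 2) ∂(gaussianReal 0 1) =
      ∫ s, g s ∂(gaussianReal 0 1) := by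
  simp only [integral_gaussianReal_eq_integral_smul one_ne_zero, smul_eq_mul]
  rw [← integral_add_right_eq_self (fun x ↦ gaussianPDFReal 0 1 x * g x) a]
  refine integral_congr_ae (ae_of_all _ fun s ↦ ?_)
  simp only [gaussianPDFReal_zero_one_add]
  ring

theorem integrable_comp_add_mul_exp_gaussianReal {g : ℝ → ℝ}
    (hg : Integrable g (gaussianReal 0 1)) (a : ℝ) :
    Integrable (fun s ↦ g (s + a) * Real.exp (-a * s - a ^ 2 / 2)) (gaussianReal 0 1) := by
  rw [integrable_gaussianReal_iff] at hg ⊢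
  refine (hg.comp_add_right a).congr (ae_of_all _ fun s ↦ ?_)
  simp only [gaussianPDFReal_zero_one_add]
  ring

theorem integrable_exp_mul_sub_gaussianReal (a b : ℝ) :
    Integrable (fun s ↦ Real.exp (a * s - b)) (gaussianReal 0 1) := by
  simpa only [Real.exp_sub] using
    (integrable_exp_mul_gaussianReal (μ := 0) (v := 1) a).div_const (Real.exp b)

/-- The tail `Pr[s < -T]` of a standard Gaussian `s`. -/
noncomputable def gaussianTail (T : ℝ) : ℝ := (gaussianReal 0 1).real (Set.Iio (-T))

theorem gaussianTail_pos (T : ℝ) : 0 < gaussianTail T :=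
  measureReal_gaussianReal_pos isOpen_Iio (Set.nonempty_Iio)

theorem gaussianTail_le_one (T : ℝ) : gaussianTail T ≤ 1 := measureReal_le_one

theorem gaussianTail_antitone : Antitone gaussianTail := fun _ _ h ↦
  measureReal_mono (Set.Iio_subset_Iio (neg_le_neg h))

theorem measureReal_gaussianReal_Ioi (T : ℝ) :
    (gaussianReal 0 1).real (Set.Ioi T) = gaussianTail T := by
  have map_neg := gaussianReal_map_neg (μ := 0) (v := 1)
  rw [neg_zero] at map_neg
  rw [gaussianTail, ← map_neg, map_measureReal_apply measurable_neg measurableSet_Iio,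
    map_neg]
  congr 1
  ext
  simp

theorem gaussianTail_zero : gaussianTail 0 = 1 / 2 := by
  have := nullSingletonClass_gaussianReal (μ := 0) (v := 1) one_ne_zero
  have compl := measureReal_add_measureReal_compl (μ := gaussianReal 0 1)
    (measurableSet_Ioi (a := (0 : ℝ)))
  have Iic_eq : (gaussianReal 0 1).real (Set.Iic 0) = gaussianTail 0 := by
    rw [gaussianTail, neg_zero, measureReal_congr Iio_ae_eq_Iic]
  rw [Set.compl_Ioi, Iic_eq, measureReal_gaussianReal_Ioi, probReal_univ] at compl
  linarith

theorem gaussianTail_add (T a : ℝ) :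
    gaussianTail (T + a) =
      ∫ s in Set.Iio (-T), Real.exp (a * s - a ^ 2 / 2) ∂(gaussianReal 0 1) := by
  have shift := integral_comp_add_mul_exp_gaussianReal
    ((Set.Iio (-(T + a))).indicator fun _ ↦ (1 : ℝ)) (-a)
  rw [integral_indicator measurableSet_Iio, setIntegral_one_eq_measureReal] at shift
  rw [gaussianTail, ← integral_indicator measurableSet_Iio, ← shift]
  refine integral_congr_ae (ae_of_all _ fun s ↦ ?_)
  have mem_iff : s + -a < -(T + a) ↔ s < -T := by constructor <;> intro _ <;> linarith
  simp only [Set.indicator_apply, Set.mem_Iio, mem_iff]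
  split_ifs <;> simp

theorem gaussianTail_add_le {T a : ℝ} (ha : 0 ≤ a) :
    gaussianTail (T + a) ≤ Real.exp (-a * T - a ^ 2 / 2) * gaussianTail T := by
  rw [gaussianTail_add]
  calc ∫ s in Set.Iio (-T), Real.exp (a * s - a ^ 2 / 2) ∂(gaussianReal 0 1)
      ≤ ∫ _ in Set.Iio (-T), Real.exp (-a * T - a ^ 2 / 2) ∂(gaussianReal 0 1) := by
        refine setIntegral_mono_on (integrable_exp_mul_sub_gaussianReal _ _).integrableOn
          (integrable_const _).integrableOn measurableSet_Iio fun s (hs : s < -T) ↦ ?_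
        rw [Real.exp_le_exp]
        nlinarith
    _ = Real.exp (-a * T - a ^ 2 / 2) * gaussianTail T := by
        rw [setIntegral_const, smul_eq_mul, mul_comm, gaussianTail]

theorem gaussianTail_le_exp {T : ℝ} (hT : 0 ≤ T) : gaussianTail T ≤ Real.exp (-T ^ 2 / 2) := by
  have chernoff := gaussianTail_add_le (T := 0) hT
  rw [zero_add, mul_zero, zero_sub, ← neg_div] at chernoff
  exact chernoff.trans (mul_le_of_le_one_right (Real.exp_pos _).le (gaussianTail_le_one 0))

theorem le_gaussianTail_add {T a : ℝ} (hT : 0 ≤ T) (ha : 0 ≤ a) :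
    (1 - Real.exp (-1 / 2)) * Real.exp (-a * (T + 1) - a ^ 2 / 2) * gaussianTail T ≤
      gaussianTail (T + a) := by
  have tail_succ : gaussianTail (T + 1) ≤ Real.exp (-1 / 2) * gaussianTail T := by
    refine (gaussianTail_add_le zero_le_one).trans
      (mul_le_mul_of_nonneg_right ?_ (gaussianTail_pos T).le)
    rw [Real.exp_le_exp]
    linarith
  have slab : (gaussianReal 0 1).real (Set.Ico (-(T + 1)) (-T)) =
      gaussianTail T - gaussianTail (T + 1) := by
    rw [gaussianTail, gaussianTail,
      ← measureReal_sdiff (Set.Iio_subset_Iio (by linarith)) measurableSet_Iio]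
    congr 1
    ext
    simp [and_comm]
  calc (1 - Real.exp (-1 / 2)) * Real.exp (-a * (T + 1) - a ^ 2 / 2) * gaussianTail T
      = (gaussianTail T - Real.exp (-1 / 2) * gaussianTail T) *
          Real.exp (-a * (T + 1) - a ^ 2 / 2) := by ring
    _ ≤ (gaussianReal 0 1).real (Set.Ico (-(T + 1)) (-T)) *
          Real.exp (-a * (T + 1) - a ^ 2 / 2) := by
        rw [slab]
        gcongr
    _ = ∫ _ in Set.Ico (-(T + 1)) (-T),
          Real.exp (-a * (T + 1) - a ^ 2 / 2) ∂(gaussianReal 0 1) := by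
        rw [setIntegral_const, smul_eq_mul]
    _ ≤ ∫ s in Set.Ico (-(T + 1)) (-T), Real.exp (a * s - a ^ 2 / 2) ∂(gaussianReal 0 1) := by
        refine setIntegral_mono_on (integrable_const _).integrableOn
          (integrable_exp_mul_sub_gaussianReal _ _).integrableOn measurableSet_Ico fun s hs ↦ ?_
        rw [Real.exp_le_exp]
        nlinarith [hs.1]
    _ ≤ ∫ s in Set.Iio (-T), Real.exp (a * s - a ^ 2 / 2) ∂(gaussianReal 0 1) :=
        setIntegral_mono_set (integrable_exp_mul_sub_gaussianReal _ _).integrableOn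
          (ae_of_all _ fun s ↦ (Real.exp_pos _).le) (Set.Ico_subset_Iio_self.eventuallyLE)
    _ = gaussianTail (T + a) := (gaussianTail_add T a).symm

theorem exists_mul_gaussianTail_le_gaussianTail_add : ∃ c : ℝ, 0 < c ∧ ∀ T a : ℝ, |a| ≤ 2 →
    |a| * T ≤ 2 → c * gaussianTail T ≤ gaussianTail (T + a) := by
  have slab_pos : 0 < 1 - Real.exp (-1 / 2) := sub_pos.2 (Real.exp_lt_one_iff.2 (by norm_num))
  refine ⟨min (gaussianTail 2) ((1 - Real.exp (-1 / 2)) * Real.exp (-6)),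
    lt_min (gaussianTail_pos 2) (by positivity), fun T a ha haT ↦ ?_⟩
  have tail_nonneg := (gaussianTail_pos T).le
  rcases le_or_gt a 0 with a_nonpos | a_pos
  · calc _ ≤ gaussianTail T :=
          mul_le_of_le_one_left tail_nonneg ((min_le_left _ _).trans (gaussianTail_le_one 2))
      _ ≤ gaussianTail (T + a) := gaussianTail_antitone (by linarith)
  rw [abs_of_pos a_pos] at ha haT
  rcases lt_or_ge T 0 with T_neg | T_nonneg
  · calc _ ≤ min (gaussianTail 2) _ :=
          mul_le_of_le_one_right (le_min (gaussianTail_pos 2).le (by positivity))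
            (gaussianTail_le_one T)
      _ ≤ gaussianTail 2 := min_le_left _ _
      _ ≤ gaussianTail (T + a) := gaussianTail_antitone (by linarith)
  · refine le_trans ?_ (le_gaussianTail_add T_nonneg a_pos.le)
    gcongr
    refine (min_le_right _ _).trans ?_
    gcongr
    nlinarith

theorem two_thirds_le_log_one_div_add_one {z : ℝ} (hz : 0 < z) (hz1 : z ≤ 1) :
    2 / 3 ≤ Real.log (1 / z + 1) := by
  have one_le : 1 ≤ 1 / z := (one_le_div hz).2 hz1
  have := Real.log_le_log two_pos (by linarith : 2 ≤ 1 / z + 1)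
  linarith [Real.log_two_gt_d9]

theorem sq_le_two_mul_log_of_le_gaussianTail {T z : ℝ} (hT : 0 ≤ T) (hz : 0 < z)
    (hzT : z ≤ gaussianTail T) : T ^ 2 ≤ 2 * Real.log (1 / z + 1) := by
  have log_le : Real.log z ≤ -T ^ 2 / 2 :=
    (Real.log_le_iff_le_exp hz).2 (hzT.trans (gaussianTail_le_exp hT))
  have log_inv_le : Real.log (1 / z) ≤ Real.log (1 / z + 1) :=
    Real.log_le_log (by positivity) (by linarith)
  rw [one_div, Real.log_inv, ← one_div] at log_inv_le
  linarith

theorem exists_mul_gaussianTail_le_of_abs_le : ∃ c : ℝ, 0 < c ∧ ∀ T a z : ℝ, 0 < z → z ≤ 1 →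
    z ≤ gaussianTail T → |a| ≤ 1 / √(Real.log (1 / z + 1)) →
    c * gaussianTail T ≤ gaussianTail (T + a) := by
  obtain ⟨c, hc, tail_shift⟩ := exists_mul_gaussianTail_le_gaussianTail_add
  refine ⟨c, hc, fun T a z hz hz1 hzT ha ↦ ?_⟩
  have hL := two_thirds_le_log_one_div_add_one hz hz1
  set L := Real.log (1 / z + 1)
  have half_le_sqrt : 1 / 2 ≤ √L := Real.le_sqrt_of_sq_le (by linarith)
  have sqrt_pos : 0 < √L := by linarith
  refine tail_shift T a (ha.trans ((div_le_iff₀ sqrt_pos).2 (by linarith))) ?_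
  rcases le_or_gt 0 T with T_nonneg | T_neg
  · have T_le : T ≤ 2 * √L := by
      have := sq_le_two_mul_log_of_le_gaussianTail T_nonneg hz hzT
      nlinarith [Real.sq_sqrt (by linarith : 0 ≤ L)]
    calc |a| * T ≤ 1 / √L * (2 * √L) := mul_le_mul ha T_le T_nonneg (by positivity)
      _ = 2 := by field_simp
  · nlinarith [abs_nonneg a]

end Gaussian

section VarianceContraction

theorem IsLogConcave.le_of_one_le {q : ℝ → ℝ} (hq : IsLogConcave q) {x y z : ℝ} (hxy : x < y)
    (hyz : y < z) (hx : 1 ≤ q x) (hz : q z ≤ 1) : q z ≤ q y := by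
  rcases (hq.nonneg z).eq_or_lt with z_zero | z_pos
  · exact z_zero ▸ hq.nonneg y
  have zx : 0 < z - x := by linarith
  have weights : (z - y) / (z - x) + (y - x) / (z - x) = 1 := by field_simp; ring
  have y_eq : ((z - y) / (z - x)) • x + ((y - x) / (z - x)) • z = y := by
    simp only [smul_eq_mul]; field_simp; ring
  calc q z = 1 * q z ^ (1 : ℝ) := by rw [Real.rpow_one, one_mul]
    _ ≤ q x ^ ((z - y) / (z - x)) * q z ^ ((y - x) / (z - x)) := by
      refine mul_le_mul (Real.one_le_rpow hx (div_nonneg (by linarith) zx.le)) ?_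
        (Real.rpow_nonneg z_pos.le _) (Real.rpow_nonneg (hq.nonneg x) _)
      exact Real.rpow_le_rpow_of_exponent_ge z_pos hz ((div_le_one zx).2 (by linarith))
    _ ≤ q y := (hq.rpow_mul_rpow_le x z _ _ (div_pos (by linarith) zx)
        (div_pos (by linarith) zx) weights).trans_eq (congrArg q y_eq)

theorem IsLogConcave.mul_le_sq {q : ℝ → ℝ} (hq : IsLogConcave q) (x y : ℝ) :
    q x * q y ≤ q ((x + y) / 2) ^ 2 := by
  have midpoint := hq.rpow_mul_rpow_le x y (1 / 2) (1 / 2) (by norm_num) (by norm_num) (by norm_num)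
  have mid_eq : (1 / 2 : ℝ) • x + (1 / 2 : ℝ) • y = (x + y) / 2 := by simp only [smul_eq_mul]; ring
  rw [mid_eq, ← Real.sqrt_eq_rpow, ← Real.sqrt_eq_rpow, ← Real.sqrt_mul (hq.nonneg x)] at midpoint
  exact Real.sqrt_le_iff.1 midpoint |>.2

theorem IsLogConcave.sub_mul_sub_mul_nonneg {q : ℝ → ℝ} (hq : IsLogConcave q) {l r : ℝ}
    (hl : IsGLB {s | 1 ≤ q s} l) (hr : IsLUB {s | 1 ≤ q s} r) (hlr : l ≤ r) (s : ℝ) :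
    0 ≤ (s - l) * (r - s) * (q s - 1) := by
  rcases lt_or_ge s l with sl | ls
  · have : q s < 1 := not_le.1 fun h ↦ (hl.1 h).not_gt sl
    exact mul_nonneg_of_nonpos_of_nonpos (by nlinarith) (by linarith)
  rcases lt_or_ge r s with rs | sr
  · have : q s < 1 := not_le.1 fun h ↦ (hr.1 h).not_gt rs
    exact mul_nonneg_of_nonpos_of_nonpos (by nlinarith) (by linarith)
  rcases ls.eq_or_lt with rfl | ls
  · simp
  rcases sr.eq_or_lt with rfl | sr
  · simp
  obtain ⟨x, hx, -, xs⟩ := hl.exists_between ls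
  obtain ⟨y, hy, sy, -⟩ := hr.exists_between sr
  have : 1 ≤ q s := hq.ordConnected_superlevel.out hx hy ⟨xs.le, sy.le⟩
  exact mul_nonneg (by nlinarith) (by linarith)

/-- `q` is the density, relative to the standard Gaussian, of a centred probability measure on `ℝ`
with finite variance, and `q` is log-concave. -/
structure IsCenteredDensity (q : ℝ → ℝ) : Prop where
  isLogConcave : IsLogConcave q
  integrable : Integrable q (gaussianReal 0 1)
  integrable_mul : Integrable (fun s ↦ s * q s) (gaussianReal 0 1)
  integrable_sq_mul : Integrable (fun s ↦ s ^ 2 * q s) (gaussianReal 0 1)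
  integral_eq_one : ∫ s, q s ∂(gaussianReal 0 1) = 1
  integral_mul_eq_zero : ∫ s, s * q s ∂(gaussianReal 0 1) = 0

namespace IsCenteredDensity

variable {q : ℝ → ℝ} {l r T : ℝ}

theorem integrable_and_integral_quadratic_mul (hq : IsCenteredDensity q) (A B C : ℝ) :
    Integrable (fun s ↦ (A + B * s + C * s ^ 2) * (q s - 1)) (gaussianReal 0 1) ∧
      ∫ s, (A + B * s + C * s ^ 2) * (q s - 1) ∂(gaussianReal 0 1) =
        C * (∫ s, s ^ 2 * q s ∂(gaussianReal 0 1) - 1) := by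
  have int_const : Integrable (fun s ↦ A * (q s - 1)) (gaussianReal 0 1) :=
    (hq.integrable.sub (integrable_const 1)).const_mul A
  have int_lin : Integrable (fun s ↦ B * (s * q s - s)) (gaussianReal 0 1) :=
    (hq.integrable_mul.sub integrable_id_gaussianReal).const_mul B
  have int_sq : Integrable (fun s ↦ C * (s ^ 2 * q s - s ^ 2)) (gaussianReal 0 1) :=
    (hq.integrable_sq_mul.sub (integrable_pow_gaussianReal 2)).const_mul C
  have expand : (fun s ↦ (A + B * s + C * s ^ 2) * (q s - 1)) = fun s ↦
      A * (q s - 1) + B * (s * q s - s) + C * (s ^ 2 * q s - s ^ 2) := by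
    ext; ring
  rw [expand]
  have int_affine : Integrable (fun s ↦ A * (q s - 1) + B * (s * q s - s)) (gaussianReal 0 1) :=
    int_const.add int_lin
  refine ⟨int_affine.add int_sq, ?_⟩
  rw [integral_add int_affine int_sq, integral_add int_const int_lin,
    integral_const_mul, integral_const_mul, integral_const_mul]
  rw [integral_sub hq.integrable (integrable_const _),
    integral_sub hq.integrable_mul integrable_id_gaussianReal,
    integral_sub hq.integrable_sq_mul (integrable_pow_gaussianReal 2), hq.integral_eq_one,
    hq.integral_mul_eq_zero, integral_sq_gaussianReal, integral_id_gaussianReal]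
  simp

theorem integrable_sub_mul_sub (hq : IsCenteredDensity q) (l r : ℝ) :
    Integrable (fun s ↦ (s - l) * (r - s) * (q s - 1)) (gaussianReal 0 1) := by
  convert (hq.integrable_and_integral_quadratic_mul (-(l * r)) (l + r) (-1)).1 using 2
  ring

theorem integral_sub_mul_sub (hq : IsCenteredDensity q) (l r : ℝ) :
    ∫ s, (s - l) * (r - s) * (q s - 1) ∂(gaussianReal 0 1) =
      ∫ s, (1 - s ^ 2) * q s ∂(gaussianReal 0 1) := by
  calc _ = ∫ s, (-(l * r) + (l + r) * s + -1 * s ^ 2) * (q s - 1) ∂(gaussianReal 0 1) := by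
        congr 1; ext; ring
    _ = 1 - ∫ s, s ^ 2 * q s ∂(gaussianReal 0 1) := by
        rw [(hq.integrable_and_integral_quadratic_mul _ _ _).2]; ring
    _ = ∫ s, (1 - s ^ 2) * q s ∂(gaussianReal 0 1) := by
        simp only [sub_mul, one_mul]
        rw [integral_sub hq.integrable hq.integrable_sq_mul, hq.integral_eq_one]

theorem exists_one_le (hq : IsCenteredDensity q) : ∃ s, 1 ≤ q s := by
  simpa only [hq.integral_eq_one] using exists_integral_le hq.integrable

theorem exists_isGLB_superlevel (hq : IsCenteredDensity q) (hT : ∀ s < -T, q s = 0) :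
    ∃ l, -T ≤ l ∧ IsGLB {s | 1 ≤ q s} l := by
  have lower : -T ∈ lowerBounds {s | 1 ≤ q s} := fun s (hs : 1 ≤ q s) ↦ by
    by_contra! h
    linarith [hT s h]
  exact ⟨_, le_csInf hq.exists_one_le lower, isGLB_csInf hq.exists_one_le ⟨_, lower⟩⟩

-- Otherwise `q - 1` would change sign exactly once, at `l`, so that `∫ (s - l) (q - 1) > 0`.
theorem exists_isLUB_superlevel (hq : IsCenteredDensity q) (hT : ∀ s < -T, q s = 0) :
    ∃ r, IsLUB {s | 1 ≤ q s} r := by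
  refine ⟨_, isLUB_csSup hq.exists_one_le ?_⟩
  obtain ⟨l, Tl, hl⟩ := hq.exists_isGLB_superlevel hT
  by_contra unbounded
  have nonneg : 0 ≤ fun s ↦ (-l + 1 * s + 0 * s ^ 2) * (q s - 1) := fun s ↦ by
    simp only [Pi.zero_apply]
    rcases lt_trichotomy s l with sl | rfl | ls
    · have : q s < 1 := not_le.1 fun h ↦ (hl.1 h).not_gt sl
      nlinarith
    · simp
    · obtain ⟨x, hx, -, xs⟩ := hl.exists_between ls
      obtain ⟨y, hy, sy⟩ := not_bddAbove_iff.1 unbounded s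
      have : 1 ≤ q s := hq.isLogConcave.ordConnected_superlevel.out hx hy ⟨xs.le, sy.le⟩
      nlinarith
  have ⟨int, value⟩ := hq.integrable_and_integral_quadratic_mul (-l) 1 0
  rw [zero_mul] at value
  refine value.not_gt ((integral_pos_iff_support_of_nonneg nonneg int).2 ?_)
  have tail_pos := gaussianTail_pos T
  rw [gaussianTail, measureReal_def, ENNReal.toReal_pos_iff] at tail_pos
  refine tail_pos.1.trans_le (measure_mono fun s (hs : s < -T) ↦ ?_)
  rw [Function.mem_support, hT s hs]
  intro h
  linarith

theorem mul_measureReal_le (hq : IsCenteredDensity q) (hl : IsGLB {s | 1 ≤ q s} l)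
    (hr : IsLUB {s | 1 ≤ q s} r) {B : Set ℝ} (hB : MeasurableSet B) {κ : ℝ}
    (hκ : ∀ s ∈ B, κ ≤ (s - l) * (r - s) * (q s - 1)) :
    κ * (gaussianReal 0 1).real B ≤ ∫ s, (1 - s ^ 2) * q s ∂(gaussianReal 0 1) := by
  have int := hq.integrable_sub_mul_sub l r
  have hlr := isGLB_le_isLUB hl hr hq.exists_one_le
  calc κ * (gaussianReal 0 1).real B = ∫ _ in B, κ ∂(gaussianReal 0 1) := by
        rw [setIntegral_const, smul_eq_mul, mul_comm]
    _ ≤ ∫ s in B, (s - l) * (r - s) * (q s - 1) ∂(gaussianReal 0 1) :=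
        setIntegral_mono_on (integrable_const κ).integrableOn int.integrableOn hB hκ
    _ ≤ ∫ s, (s - l) * (r - s) * (q s - 1) ∂(gaussianReal 0 1) :=
        setIntegral_le_integral int
          (ae_of_all _ fun s ↦ hq.isLogConcave.sub_mul_sub_mul_nonneg hl hr hlr s)
    _ = ∫ s, (1 - s ^ 2) * q s ∂(gaussianReal 0 1) := hq.integral_sub_mul_sub l r

theorem mul_gaussianTail_add_le (hq : IsCenteredDensity q) (hl : IsGLB {s | 1 ≤ q s} l)
    (hr : IsLUB {s | 1 ≤ q s} r) (hT : ∀ s < -T, q s = 0) (hTl : -T ≤ l) {a : ℝ} (ha : 0 ≤ a) :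
    a * (r + T + a) * gaussianTail (T + a) ≤ ∫ s, (1 - s ^ 2) * q s ∂(gaussianReal 0 1) := by
  have hlr := isGLB_le_isLUB hl hr hq.exists_one_le
  refine hq.mul_measureReal_le hl hr measurableSet_Iio fun s (hs : s < -(T + a)) ↦ ?_
  rw [hT s (by linarith)]
  calc a * (r + T + a) ≤ (l - s) * (r - s) :=
        mul_le_mul (by linarith) (by linarith) (by linarith) (by linarith)
    _ = (s - l) * (r - s) * (0 - 1) := by ring

/- If `1/2 < q 0 < 1`, then log-concavity gives `q ≤ q 0` on the positive half-line, while
`q s * q 0 ≤ 1` wherever `1 ≤ q s`; hence `q` has total mass less than one. -/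
theorem apply_zero_le_half (hq : IsCenteredDensity q) (left : ∀ s, 1 ≤ q s → s < -3)
    (half : ∀ s, 1 ≤ q s → q (s / 2) < 1) : q 0 ≤ 1 / 2 := by
  by_contra! half_lt
  obtain ⟨x, hx⟩ := hq.exists_one_le
  have lt_one : ∀ s, -3 ≤ s → q s < 1 := fun s hs ↦ not_le.1 fun h ↦ (left s h).not_ge hs
  have pos := lt_one 0 (by norm_num)
  have bound : ∀ s, q s - 1 ≤ (Set.Iio (-3 : ℝ)).indicator (fun _ ↦ 2 * (1 - q 0)) s +
      (Set.Ioi (0 : ℝ)).indicator (fun _ ↦ -(1 - q 0)) s := by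
    intro s
    simp only [Set.indicator_apply, Set.mem_Iio, Set.mem_Ioi]
    rcases le_or_gt 1 (q s) with hs | hs
    · have product : q s * q 0 ≤ 1 := by
        refine (hq.isLogConcave.mul_le_sq s 0).trans (pow_le_one₀ (hq.isLogConcave.nonneg _) ?_)
        simpa only [add_zero] using (half s hs).le
      have := left s hs
      rw [if_pos this, if_neg (by linarith)]
      nlinarith
    · have monotone : 0 < s → q s ≤ q 0 := fun s_pos ↦
        hq.isLogConcave.le_of_one_le (by linarith [left x hx]) s_pos hx hs.le
      split_ifs with h3 h0 h0
      · linarith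
      · linarith
      · linarith [monotone h0]
      · linarith
  have int_left : Integrable ((Set.Iio (-3 : ℝ)).indicator fun _ ↦ 2 * (1 - q 0))
      (gaussianReal 0 1) := (integrable_const _).indicator measurableSet_Iio
  have int_right : Integrable ((Set.Ioi (0 : ℝ)).indicator fun _ ↦ -(1 - q 0))
      (gaussianReal 0 1) := (integrable_const _).indicator measurableSet_Ioi
  have mass := integral_mono (hq.integrable.sub (integrable_const 1)) (int_left.add int_right) bound
  rw [integral_sub' hq.integrable (integrable_const 1), integral_add' int_left int_right,
    hq.integral_eq_one, integral_indicator measurableSet_Iio,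
    integral_indicator measurableSet_Ioi, setIntegral_const, setIntegral_const,
    measureReal_gaussianReal_Ioi, gaussianTail_zero, ← gaussianTail, integral_const,
    probReal_univ, smul_eq_mul, smul_eq_mul, smul_eq_mul] at mass
  have tail_three : gaussianTail 3 < 1 / 4 := by
    refine (gaussianTail_le_exp (by norm_num)).trans_lt ?_
    rw [neg_div, Real.exp_neg, inv_lt_comm₀ (Real.exp_pos _) (by norm_num)]
    linarith [Real.add_one_le_exp ((3 : ℝ) ^ 2 / 2)]
  nlinarith

theorem half_mul_gaussianTail_one_le (hq : IsCenteredDensity q) (hl : IsGLB {s | 1 ≤ q s} l)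
    (hr : IsLUB {s | 1 ≤ q s} r) (hr3 : r < -3) (hrl : r < l / 2) :
    1 / 2 * gaussianTail 1 ≤ ∫ s, (1 - s ^ 2) * q s ∂(gaussianReal 0 1) := by
  have lt_one : ∀ s, r < s → q s < 1 := fun s hs ↦ not_le.1 fun h ↦ (hr.1 h).not_gt hs
  have hlr := isGLB_le_isLUB hl hr hq.exists_one_le
  have at_zero : q 0 ≤ 1 / 2 := by
    refine hq.apply_zero_le_half (fun s hs ↦ (hr.1 hs).trans_lt (by linarith))
      fun s hs ↦ lt_one _ ?_
    linarith [hl.1 hs]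
  obtain ⟨x, hx⟩ := hq.exists_one_le
  have gain : ∀ s ∈ Set.Ioi (1 : ℝ), 1 / 2 ≤ (s - l) * (r - s) * (q s - 1) := fun s hs ↦ by
    have hs : 1 < s := hs
    have : q s ≤ q 0 := hq.isLogConcave.le_of_one_le (by linarith [hr.1 hx]) (by linarith) hx
      (lt_one s (by linarith)).le
    nlinarith [hlr, mul_nonneg (by linarith : 0 ≤ s - r - 1)
      (by linarith [hlr] : 0 ≤ s - l)]
  rw [← measureReal_gaussianReal_Ioi]
  exact hq.mul_measureReal_le hl hr measurableSet_Ioi gain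

end IsCenteredDensity

theorem exists_variance_contraction : ∃ c : ℝ, 0 < c ∧ ∀ (q : ℝ → ℝ) (T : ℝ),
    IsCenteredDensity q → (∀ s < -T, q s = 0) →
      c * gaussianTail T ≤ ∫ s, (1 - s ^ 2) * q s ∂(gaussianReal 0 1) := by
  obtain ⟨c, hc, tail_shift⟩ := exists_mul_gaussianTail_le_gaussianTail_add
  refine ⟨min (1 / 9 * c) (1 / 2 * gaussianTail 1),
    lt_min (by positivity) (mul_pos (by norm_num) (gaussianTail_pos 1)), fun q T hq hT ↦ ?_⟩
  obtain ⟨l, hTl, hl⟩ := hq.exists_isGLB_superlevel hT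
  obtain ⟨r, hr⟩ := hq.exists_isLUB_superlevel hT
  have hTr : -T ≤ r := hTl.trans (isGLB_le_isLUB hl hr hq.exists_one_le)
  have tail_nonneg := (gaussianTail_pos T).le
  have of_shift : ∀ a, 0 ≤ a → a ≤ 2 → a * T ≤ 2 → 1 / 9 ≤ a * (r + T + a) →
      min (1 / 9 * c) (1 / 2 * gaussianTail 1) * gaussianTail T ≤
        ∫ s, (1 - s ^ 2) * q s ∂(gaussianReal 0 1) := fun a ha ha2 haT hκ ↦ by
    rw [← abs_of_nonneg ha] at ha2 haT
    calc _ ≤ 1 / 9 * c * gaussianTail T := mul_le_mul_of_nonneg_right (min_le_left _ _) tail_nonneg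
      _ = 1 / 9 * (c * gaussianTail T) := mul_assoc _ _ _
      _ ≤ a * (r + T + a) * gaussianTail (T + a) :=
        mul_le_mul hκ (tail_shift T a ha2 haT) (by positivity) (by linarith)
      _ ≤ _ := hq.mul_gaussianTail_add_le hl hr hT hTl ha
  rcases le_or_gt T 6 with T_le | T_gt
  · exact of_shift (1 / 3) (by norm_num) (by norm_num) (by linarith) (by linarith)
  rcases le_or_gt (-T / 2) r with r_ge | r_lt
  · have T_pos : 0 < T := by linarith
    refine of_shift (2 / T) (by positivity) ((div_le_iff₀ T_pos).2 (by linarith))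
      (div_mul_cancel₀ 2 T_pos.ne').le ?_
    calc (1 : ℝ) / 9 ≤ 2 / T * (T / 2) := by field_simp; norm_num
      _ ≤ 2 / T * (r + T + 2 / T) := by
        refine mul_le_mul_of_nonneg_left ?_ (by positivity)
        linarith [show 0 < 2 / T by positivity]
  calc _ ≤ 1 / 2 * gaussianTail 1 * 1 :=
        mul_le_mul (min_le_right _ _) (gaussianTail_le_one T) tail_nonneg
          (mul_nonneg (by norm_num) (gaussianTail_pos 1).le)
    _ ≤ _ := by
        rw [mul_one]
        exact hq.half_mul_gaussianTail_one_le hl hr (by linarith) (by linarith)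

theorem integrable_mul_of_le_one {Ω : Type*} [MeasurableSpace Ω] {μ : Measure Ω} {f h : Ω → ℝ}
    (hf : Integrable f μ) (hh : Measurable h) (h0 : 0 ≤ h) (h1 : h ≤ 1) :
    Integrable (fun s ↦ f s * h s) μ :=
  hf.mul_bdd (c := 1) hh.aestronglyMeasurable
    (ae_of_all _ fun s ↦ by rw [Real.norm_of_nonneg (h0 s)]; exact h1 s)

/-- The mean of the probability measure with density proportional to `h` relative to the standard
Gaussian. -/
noncomputable def weightMean (h : ℝ → ℝ) : ℝ :=
  (∫ s, s * h s ∂(gaussianReal 0 1)) / ∫ s, h s ∂(gaussianReal 0 1)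

/-- The density, relative to the standard Gaussian, of the probability measure obtained from the
weight `h` by normalizing and translating its mean to the origin; the exponential is the
Cameron–Martin factor of the translation. -/
noncomputable def recentred (h : ℝ → ℝ) (s : ℝ) : ℝ :=
  (∫ t, h t ∂(gaussianReal 0 1))⁻¹ *
    (h (s + weightMean h) * Real.exp (-weightMean h * s - weightMean h ^ 2 / 2))

section Recentred

variable {h : ℝ → ℝ}

theorem integral_mul_recentred (h : ℝ → ℝ) (φ : ℝ → ℝ) :
    ∫ s, φ s * recentred h s ∂(gaussianReal 0 1) =
      (∫ s, h s ∂(gaussianReal 0 1))⁻¹ * ∫ s, φ (s - weightMean h) * h s ∂(gaussianReal 0 1) := by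
  rw [← integral_comp_add_mul_exp_gaussianReal (fun s ↦ φ (s - weightMean h) * h s) (weightMean h),
    ← integral_const_mul]
  congr 1
  ext s
  rw [recentred, add_sub_cancel_right]
  ring

theorem integrable_mul_recentred {φ : ℝ → ℝ}
    (hφ : Integrable (fun s ↦ φ (s - weightMean h) * h s) (gaussianReal 0 1)) :
    Integrable (fun s ↦ φ s * recentred h s) (gaussianReal 0 1) := by
  refine ((integrable_comp_add_mul_exp_gaussianReal hφ (weightMean h)).const_mul
    (∫ t, h t ∂(gaussianReal 0 1))⁻¹).congr (ae_of_all _ fun s ↦ ?_)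
  simp only [recentred, add_sub_cancel_right]
  ring

theorem IsLogConcave.recentred (hh : IsLogConcave h) (pos : 0 < ∫ s, h s ∂(gaussianReal 0 1)) :
    IsLogConcave (recentred h) := by
  have shifted : IsLogConcave fun s ↦ h (s + weightMean h) := by
    have := hh.comp_affineMap (AffineMap.id ℝ ℝ + AffineMap.const ℝ ℝ (weightMean h))
    exact this
  have tilt : IsLogConcave fun s : ℝ ↦ Real.exp (-weightMean h * s -
      (weightMean h ^ 2 / 2 + Real.log (∫ s, h s ∂(gaussianReal 0 1)))) := by
    refine IsLogConcave.exp ⟨convex_univ, fun x _ y _ a b _ _ hab ↦ le_of_eq ?_⟩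
    simp only [smul_eq_mul]
    linear_combination -(weightMean h ^ 2 / 2 + Real.log (∫ s, h s ∂(gaussianReal 0 1))) * hab
  convert shifted.mul tilt using 2 with s
  rw [_root_.recentred, ← sub_sub, Real.exp_sub _ (Real.log _), Real.exp_log pos]
  ring

theorem integrable_quadratic_mul (hm : Measurable h) (h0 : 0 ≤ h) (h1 : h ≤ 1) (A B C : ℝ) :
    Integrable (fun s ↦ (A + B * s + C * s ^ 2) * h s) (gaussianReal 0 1) :=
  integrable_mul_of_le_one (((integrable_const A).add (integrable_id_gaussianReal.const_mul B)).add
    ((integrable_pow_gaussianReal 2).const_mul C)) hm h0 h1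

theorem integral_sub_weightMean_mul (hm : Measurable h) (h0 : 0 ≤ h) (h1 : h ≤ 1)
    (pos : 0 < ∫ s, h s ∂(gaussianReal 0 1)) :
    ∫ s, (s - weightMean h) * h s ∂(gaussianReal 0 1) = 0 := by
  have int_one : Integrable (fun s ↦ weightMean h * h s) (gaussianReal 0 1) := by
    simpa using integrable_quadratic_mul hm h0 h1 (weightMean h) 0 0
  have int_id : Integrable (fun s ↦ s * h s) (gaussianReal 0 1) := by
    simpa using integrable_quadratic_mul hm h0 h1 0 1 0
  simp only [sub_mul]
  rw [integral_sub int_id int_one, integral_const_mul, weightMean, div_mul_cancel₀ _ pos.ne',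
    sub_self]

theorem isCenteredDensity_recentred (hh : IsLogConcave h) (hm : Measurable h) (h1 : h ≤ 1)
    (pos : 0 < ∫ s, h s ∂(gaussianReal 0 1)) : IsCenteredDensity (recentred h) where
  isLogConcave := hh.recentred pos
  integrable := by
    simpa using integrable_mul_recentred (φ := 1)
      (by simpa using integrable_quadratic_mul hm hh.nonneg h1 1 0 0)
  integrable_mul := integrable_mul_recentred (φ := fun s ↦ s) <| by
    convert integrable_quadratic_mul hm hh.nonneg h1 (-weightMean h) 1 0 using 2
    ring
  integrable_sq_mul := integrable_mul_recentred (φ := fun s ↦ s ^ 2) <| by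
    convert integrable_quadratic_mul hm hh.nonneg h1 (weightMean h ^ 2) (-2 * weightMean h) 1
      using 2
    ring
  integral_eq_one := by
    simpa [pos.ne'] using integral_mul_recentred h 1
  integral_mul_eq_zero := by
    rw [integral_mul_recentred h fun s ↦ s, integral_sub_weightMean_mul hm hh.nonneg h1 pos,
      mul_zero]

theorem integral_one_sub_sq_mul_recentred (hm : Measurable h) (h0 : 0 ≤ h) (h1 : h ≤ 1)
    (pos : 0 < ∫ s, h s ∂(gaussianReal 0 1)) :
    (∫ s, h s ∂(gaussianReal 0 1)) * ∫ s, (1 - s ^ 2) * recentred h s ∂(gaussianReal 0 1) =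
      ∫ s, (1 - s ^ 2 + weightMean h * s) * h s ∂(gaussianReal 0 1) := by
  set m := weightMean h
  have int_quadratic : Integrable (fun s ↦ (1 - s ^ 2 + m * s) * h s) (gaussianReal 0 1) := by
    convert integrable_quadratic_mul hm h0 h1 1 m (-1) using 2
    ring
  have int_linear : Integrable (fun s ↦ m * ((s - m) * h s)) (gaussianReal 0 1) := by
    convert integrable_quadratic_mul hm h0 h1 (-m ^ 2) m 0 using 2
    ring
  calc _ = ∫ s, (1 - (s - m) ^ 2) * h s ∂(gaussianReal 0 1) := by
        rw [integral_mul_recentred h fun s ↦ 1 - s ^ 2, mul_inv_cancel_left₀ pos.ne']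
    _ = ∫ s, ((1 - s ^ 2 + m * s) * h s + m * ((s - m) * h s)) ∂(gaussianReal 0 1) := by
        congr 1; ext; ring
    _ = _ := by
        rw [integral_add int_quadratic int_linear, integral_const_mul,
          integral_sub_weightMean_mul hm h0 h1 pos, mul_zero, add_zero]

theorem exists_weighted_variance_contraction : ∃ c : ℝ, 0 < c ∧ ∀ (h : ℝ → ℝ) (T : ℝ),
    IsLogConcave h → Measurable h → h ≤ 1 → 0 < ∫ s, h s ∂(gaussianReal 0 1) →
      (∀ s < -T, h s = 0) →
        c * (∫ s, h s ∂(gaussianReal 0 1)) * gaussianTail (T + weightMean h) ≤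
          ∫ s, (1 - s ^ 2 + weightMean h * s) * h s ∂(gaussianReal 0 1) := by
  obtain ⟨c, hc, contraction⟩ := exists_variance_contraction
  refine ⟨c, hc, fun h T hh hm h1 pos hT ↦ ?_⟩
  have contracted := contraction _ (T + weightMean h) (isCenteredDensity_recentred hh hm h1 pos)
    fun s hs ↦ by rw [recentred, hT _ (by linarith), zero_mul, mul_zero]
  rw [← integral_one_sub_sq_mul_recentred hm hh.nonneg h1 pos, mul_comm c, mul_assoc]
  exact mul_le_mul_of_nonneg_left contracted pos.le

end Recentred

end VarianceContraction

section StdGaussian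

variable {E : Type*} [NormedAddCommGroup E] [InnerProductSpace ℝ E] [FiniteDimensional ℝ E]
  [MeasurableSpace E] [BorelSpace E]

theorem stdGaussian_map_inner {e : E} (he : ‖e‖ = 1) :
    (stdGaussian E).map (fun x ↦ ⟪e, x⟫_ℝ) = gaussianReal 0 1 := by
  have := IsGaussian.map_eq_gaussianReal (μ := stdGaussian E) (innerSL ℝ e)
  rw [variance_dual_stdGaussian, innerSL_apply_norm, he, integral_strongDual_stdGaussian] at this
  simpa using! this

theorem integral_comp_inner_stdGaussian {e : E} (he : ‖e‖ = 1) {ψ : ℝ → ℝ} (hψ : Measurable ψ) :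
    ∫ x, ψ ⟪e, x⟫_ℝ ∂(stdGaussian E) = ∫ s, ψ s ∂(gaussianReal 0 1) := by
  rw [← stdGaussian_map_inner he, integral_map (by fun_prop) hψ.aestronglyMeasurable]

theorem integrable_comp_inner_stdGaussian {e : E} (he : ‖e‖ = 1) {ψ : ℝ → ℝ}
    (hψ : Integrable ψ (gaussianReal 0 1)) :
    Integrable (fun x ↦ ψ ⟪e, x⟫_ℝ) (stdGaussian E) := by
  rw [← stdGaussian_map_inner he] at hψ
  exact hψ.comp_measurable (by fun_prop)

theorem indepFun_stdGaussian {F₁ F₂ : Type*} [NormedAddCommGroup F₁] [InnerProductSpace ℝ F₁]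
    [FiniteDimensional ℝ F₁] [MeasurableSpace F₁] [BorelSpace F₁] [NormedAddCommGroup F₂]
    [InnerProductSpace ℝ F₂] [FiniteDimensional ℝ F₂] [MeasurableSpace F₂] [BorelSpace F₂]
    {L₁ : E →L[ℝ] F₁} {L₂ : E →L[ℝ] F₂} (h : L₁ ∘L L₂.adjoint = 0) :
    IndepFun L₁ L₂ (stdGaussian E) := by
  have : IsGaussian ((stdGaussian E).map (L₁.prod L₂)) := inferInstance
  have joint : HasGaussianLaw (fun x ↦ (L₁ x, L₂ x)) (stdGaussian E) := ⟨this⟩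
  refine joint.indepFun_of_covariance_inner fun a b ↦ ?_
  simp only [← ContinuousLinearMap.adjoint_inner_left]
  rw [← covarianceBilin_apply_eq_cov IsGaussian.memLp_two_id, covarianceBilin_stdGaussian]
  have orthogonal : ⟪L₁.adjoint a, L₂.adjoint b⟫_ℝ = 0 := by
    rw [ContinuousLinearMap.adjoint_inner_left, ← ContinuousLinearMap.comp_apply, h,
      zero_apply, inner_zero_right]
  simpa using! orthogonal

theorem stdGaussian_map_inner_prod_sub {e : E} (he : ‖e‖ = 1) :
    (stdGaussian E).map (fun x ↦ (⟪e, x⟫_ℝ, x - ⟪e, x⟫_ℝ • e)) =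
      (gaussianReal 0 1).prod ((stdGaussian E).map fun x ↦ x - ⟪e, x⟫_ℝ • e) := by
  have orthogonal : innerSL ℝ e ∘L
      (ContinuousLinearMap.id ℝ E - (innerSL ℝ e).smulRight e).adjoint = 0 := by
    refine ContinuousLinearMap.ext fun b ↦ ?_
    simp only [ContinuousLinearMap.comp_apply, innerSL_apply_apply,
      ContinuousLinearMap.adjoint_inner_right]
    simp [he]
  have indep := indepFun_stdGaussian orthogonal
  have := (indepFun_iff_map_prod_eq_prod_map_map (by fun_prop) (by fun_prop)).1 indep
  rw [← stdGaussian_map_inner he]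
  simpa using! this

section Slice

/-- The conditional probability of `A` under the standard Gaussian of `E`, given that the
coordinate in direction `e` equals `s`; the other coordinates are resampled independently. -/
noncomputable def sliceMass (e : E) (A : Set E) (s : ℝ) : ℝ :=
  (stdGaussian E).real {x | s • e + (x - ⟪e, x⟫_ℝ • e) ∈ A}

theorem sliceMass_eq_integral (e : E) {A : Set E} (hA : MeasurableSet A) (s : ℝ) :
    sliceMass e A s =
      ∫ x, A.indicator (1 : E → ℝ) (s • e + (x - ⟪e, x⟫_ℝ • e)) ∂(stdGaussian E) :=
  (integral_indicator_one (hA.preimage (by fun_prop))).symm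

theorem sliceMass_le_one (e : E) (A : Set E) : sliceMass e A ≤ 1 := fun _ ↦ measureReal_le_one

theorem measurable_sliceMass (e : E) {A : Set E} (hA : MeasurableSet A) :
    Measurable (sliceMass e A) := by
  simp only [funext (sliceMass_eq_integral e hA)]
  have indicator_measurable : Measurable (A.indicator (1 : E → ℝ)) := measurable_one.indicator hA
  exact (StronglyMeasurable.integral_prod_right
    (f := fun (s : ℝ) (x : E) ↦ A.indicator (1 : E → ℝ) (s • e + (x - ⟪e, x⟫_ℝ • e)))
    (indicator_measurable.comp (by fun_prop)).stronglyMeasurable).measurable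

theorem isLogConcave_sliceMass (e : E) {A : Set E} (hA : Convex ℝ A) (hm : MeasurableSet A) :
    IsLogConcave (sliceMass e A) := by
  simp only [funext (sliceMass_eq_integral e hm)]
  have jointly := (IsLogConcave.indicator_one hA).comp_affineMap
    ((LinearMap.fst ℝ ℝ E).smulRight e + (LinearMap.id - (innerₛₗ ℝ e).smulRight e) ∘ₗ
      LinearMap.snd ℝ ℝ E).toAffineMap
  refine jointly.integral_stdGaussian
    (fun _ ↦ Set.indicator_le_self' (fun _ _ ↦ zero_le_one) _) fun s ↦ ?_
  have recompose : Measurable fun x : E ↦ s • e + (x - ⟪e, x⟫_ℝ • e) := by fun_prop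
  exact (measurable_one.indicator hm).comp recompose

omit [BorelSpace E] in
theorem sliceMass_eq_zero {e : E} (he : ‖e‖ = 1) {A : Set E} {T s : ℝ}
    (hA : ∀ x ∈ A, -T ≤ ⟪e, x⟫_ℝ) (hs : s < -T) : sliceMass e A s = 0 := by
  have empty : {x | s • e + (x - ⟪e, x⟫_ℝ • e) ∈ A} = ∅ := by
    refine Set.eq_empty_of_forall_notMem fun x hx ↦ ?_
    have := hA _ hx
    rw [inner_add_right, inner_sub_right, inner_smul_right, inner_smul_right,
      real_inner_self_eq_norm_sq, he] at this
    linarith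
  rw [sliceMass, empty, measureReal_empty]

theorem setIntegral_comp_inner_stdGaussian {e : E} (he : ‖e‖ = 1) {A : Set E}
    (hA : MeasurableSet A) {ψ : ℝ → ℝ} (hψ : Measurable ψ)
    (hψi : Integrable ψ (gaussianReal 0 1)) :
    ∫ x in A, ψ ⟪e, x⟫_ℝ ∂(stdGaussian E) = ∫ s, ψ s * sliceMass e A s ∂(gaussianReal 0 1) := by
  have decompose : Measurable fun x : E ↦ (⟪e, x⟫_ℝ, x - ⟪e, x⟫_ℝ • e) := by fun_prop
  have indicator_measurable : Measurable (A.indicator (1 : E → ℝ)) := measurable_one.indicator hA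
  have integrand : Measurable fun p : ℝ × E ↦ ψ p.1 * A.indicator (1 : E → ℝ) (p.1 • e + p.2) := by
    fun_prop
  have recompose : A.indicator (fun x ↦ ψ ⟪e, x⟫_ℝ) = fun x ↦
      (fun p : ℝ × E ↦ ψ p.1 * A.indicator (1 : E → ℝ) (p.1 • e + p.2))
        (⟪e, x⟫_ℝ, x - ⟪e, x⟫_ℝ • e) := by
    ext x
    by_cases hx : x ∈ A <;> simp [hx]
  have int : Integrable (A.indicator fun x ↦ ψ ⟪e, x⟫_ℝ) (stdGaussian E) :=
    (integrable_comp_inner_stdGaussian he hψi).indicator hA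
  rw [recompose] at int
  rw [← integral_indicator hA, recompose,
    ← integral_map decompose.aemeasurable integrand.aestronglyMeasurable,
    stdGaussian_map_inner_prod_sub he, integral_prod]
  · congr 1
    ext s
    simp only
    rw [integral_const_mul, sliceMass_eq_integral e hA,
      integral_map (f := fun y ↦ A.indicator (1 : E → ℝ) (s • e + y)) (by fun_prop)
        (indicator_measurable.comp (measurable_const_add (s • e))).aestronglyMeasurable]
  · rw [← stdGaussian_map_inner_prod_sub he]
    exact (integrable_map_measure integrand.aestronglyMeasurable decompose.aemeasurable).2 int

theorem exists_convex_contraction : ∃ c : ℝ, 0 < c ∧ ∀ (E : Type*)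
    [NormedAddCommGroup E] [InnerProductSpace ℝ E] [FiniteDimensional ℝ E]
    [MeasurableSpace E] [BorelSpace E] (A : Set E) (e : E) (T : ℝ), Convex ℝ A → MeasurableSet A →
      ‖e‖ = 1 → (∀ x ∈ A, -T ≤ ⟪e, x⟫_ℝ) → 0 < (stdGaussian E).real A →
        c * (stdGaussian E).real A * gaussianTail (T + ⨍ x in A, ⟪e, x⟫_ℝ ∂(stdGaussian E)) ≤
          ∫ x in A, (1 - ⟪e, x⟫_ℝ ^ 2 + (⨍ y in A, ⟪e, y⟫_ℝ ∂(stdGaussian E)) * ⟪e, x⟫_ℝ)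
            ∂(stdGaussian E) := by
  obtain ⟨c, hc, contraction⟩ := exists_weighted_variance_contraction
  refine ⟨c, hc, fun E _ _ _ _ _ A e T hA hm he hT pos ↦ ?_⟩
  have mass := setIntegral_comp_inner_stdGaussian he hm measurable_const
    (integrable_const (μ := gaussianReal 0 1) (1 : ℝ))
  have mean := setIntegral_comp_inner_stdGaussian he hm measurable_id integrable_id_gaussianReal
  simp only [setIntegral_one_eq_measureReal, one_mul, id] at mass mean
  have mean_eq : ⨍ x in A, ⟪e, x⟫_ℝ ∂(stdGaussian E) = weightMean (sliceMass e A) := by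
    rw [setAverage_eq, smul_eq_mul, mean, mass, weightMean, inv_mul_eq_div]
  rw [mean_eq, mass]
  refine (contraction _ T (isLogConcave_sliceMass e hA hm) (measurable_sliceMass e hm)
    (sliceMass_le_one e A) (mass ▸ pos) fun s ↦ sliceMass_eq_zero he hT).trans_eq ?_
  exact (setIntegral_comp_inner_stdGaussian he hm (by fun_prop)
    (((integrable_const 1).sub (integrable_pow_gaussianReal 2)).add
      (integrable_id_gaussianReal.const_mul _))).symm

end Slice

section Polyhedron

variable {ι : Type*}

/-- The intersection of the half-spaces `0 ≤ ⟪a i, x⟫ + b i`. The normals `a i` need not be unit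
vectors and may vanish, in which case the half-space is everything or nothing. -/
def polyhedron (a : ι → E) (b : ι → ℝ) : Set E := {x | ∀ i, 0 ≤ ⟪a i, x⟫_ℝ + b i}

omit [FiniteDimensional ℝ E] [MeasurableSpace E] [BorelSpace E] in
theorem convex_polyhedron (a : ι → E) (b : ι → ℝ) : Convex ℝ (polyhedron a b) := by
  intro x hx y hy s t hs ht hst i
  have combination : ⟪a i, s • x + t • y⟫_ℝ + b i =
      s * (⟪a i, x⟫_ℝ + b i) + t * (⟪a i, y⟫_ℝ + b i) := by
    rw [inner_add_right, inner_smul_right, inner_smul_right]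
    linear_combination -b i * hst
  rw [combination]
  exact add_nonneg (mul_nonneg hs (hx i)) (mul_nonneg ht (hy i))

omit [FiniteDimensional ℝ E] in
theorem measurableSet_polyhedron [Countable ι] (a : ι → E) (b : ι → ℝ) :
    MeasurableSet (polyhedron a b) := by
  rw [polyhedron, Set.ofPred_forall]
  exact MeasurableSet.iInter fun i ↦ measurableSet_le measurable_const (by fun_prop)

theorem stdGaussian_inner_add_neg {a : E} (ha : a ≠ 0) (b : ℝ) :
    (stdGaussian E).real {x | ⟪a, x⟫_ℝ + b < 0} = gaussianTail (b / ‖a‖) := by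
  have norm_pos : 0 < ‖a‖ := norm_pos_iff.2 ha
  have unit : ‖‖a‖⁻¹ • a‖ = 1 := norm_smul_inv_norm (𝕜 := ℝ) ha
  rw [gaussianTail, ← stdGaussian_map_inner unit,
    map_measureReal_apply (by fun_prop) measurableSet_Iio]
  congr 1
  ext x
  simp only [Set.mem_ofPred_eq, Set.mem_preimage, Set.mem_Iio, real_inner_smul_left]
  rw [inv_mul_eq_div, ← neg_div, div_lt_div_iff_of_pos_right norm_pos, lt_neg_iff_add_neg]

theorem exists_violated_inequality [Fintype ι] {a : ι → E} {b : ι → ℝ}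
    (h : (stdGaussian E).real (polyhedron a b) < 1) :
    ∃ i, (1 - (stdGaussian E).real (polyhedron a b)) / Fintype.card ι ≤
      (stdGaussian E).real {x | ⟪a i, x⟫_ℝ + b i < 0} := by
  have compl_eq : (polyhedron a b)ᶜ = ⋃ i, {x | ⟪a i, x⟫_ℝ + b i < 0} := by
    ext x
    simp [polyhedron]
  have union_bound : 1 - (stdGaussian E).real (polyhedron a b) ≤
      ∑ i, (stdGaussian E).real {x | ⟪a i, x⟫_ℝ + b i < 0} := by
    rw [← probReal_compl_eq_one_sub (measurableSet_polyhedron a b), compl_eq]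
    exact measureReal_iUnion_fintype_le _
  have nonempty : Nonempty ι := by
    by_contra empty
    simp only [not_nonempty_iff] at empty
    simp [polyhedron] at h
  have card_ne : (Fintype.card ι : ℝ) ≠ 0 := Nat.cast_ne_zero.2 Fintype.card_ne_zero
  obtain ⟨i, -, hi⟩ := Finset.exists_le_of_sum_le Finset.univ_nonempty
    (f := fun _ ↦ (1 - (stdGaussian E).real (polyhedron a b)) / Fintype.card ι)
    (g := fun i ↦ (stdGaussian E).real {x | ⟪a i, x⟫_ℝ + b i < 0}) (by
      rwa [Finset.sum_const, Finset.card_univ, nsmul_eq_mul, mul_div_cancel₀ _ card_ne])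
  exact ⟨i, hi⟩

theorem exists_facet [Fintype ι] {a : ι → E} {b : ι → ℝ}
    (h0 : 0 < (stdGaussian E).real (polyhedron a b))
    (h1 : (stdGaussian E).real (polyhedron a b) < 1) :
    ∃ i, a i ≠ 0 ∧ (1 - (stdGaussian E).real (polyhedron a b)) / Fintype.card ι ≤
      gaussianTail (b i / ‖a i‖) := by
  obtain ⟨i, hi⟩ := exists_violated_inequality h1
  have normal_ne : a i ≠ 0 := by
    intro zero
    obtain ⟨x, hx⟩ : (polyhedron a b).Nonempty :=
      nonempty_of_measureReal_ne_zero h0.ne'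
    have satisfied : 0 ≤ b i := by simpa [zero] using hx i
    have : Nonempty ι := ⟨i⟩
    refine hi.not_gt ?_
    simp only [zero, inner_zero_left, zero_add, satisfied.not_gt, Set.ofPred_false,
      measureReal_empty]
    exact div_pos (sub_pos.2 h1) (Nat.cast_pos.2 Fintype.card_pos)
  exact ⟨i, normal_ne, hi.trans_eq (stdGaussian_inner_add_neg normal_ne _)⟩

end Polyhedron

end StdGaussian

section SurfaceArea

theorem gaussianReal_Icc_le {b δ M : ℝ} (hδ : 0 ≤ δ)
    (hM : ∀ s ∈ Set.Icc b (b + δ), gaussianPDFReal 0 1 s ≤ M) :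
    gaussianReal 0 1 (Set.Icc b (b + δ)) ≤ ENNReal.ofReal (δ * M) := by
  rw [gaussianReal_apply _ one_ne_zero]
  calc ∫⁻ s in Set.Icc b (b + δ), gaussianPDF 0 1 s
      ≤ ∫⁻ _ in Set.Icc b (b + δ), ENNReal.ofReal M :=
        setLIntegral_mono' measurableSet_Icc fun s hs ↦ ENNReal.ofReal_le_ofReal (hM s hs)
    _ = ENNReal.ofReal (δ * M) := by
        rw [setLIntegral_const, Real.volume_Icc, add_sub_cancel_left, mul_comm,
          ENNReal.ofReal_mul hδ]

theorem gaussianReal_Icc_le_of_tail {b δ H : ℝ} (hδ : 0 ≤ δ) (hδH : δ ≤ H / 2)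
    (hb : b < -(2 * H)) :
    gaussianReal 0 1 (Set.Icc b (b + δ)) ≤ ENNReal.ofReal (δ * Real.exp (-H ^ 2)) := by
  refine gaussianReal_Icc_le hδ fun s hs ↦ ?_
  have normalization : (√(2 * Real.pi))⁻¹ ≤ 1 := by
    refine inv_le_one_of_one_le₀ (Real.one_le_sqrt.2 ?_)
    linarith [Real.pi_gt_three]
  have exponent : Real.exp (-s ^ 2 / 2) ≤ Real.exp (-H ^ 2) := by
    rw [Real.exp_le_exp]
    nlinarith [hs.2]
  rw [gaussianPDFReal_zero_one]
  exact (mul_le_mul normalization exponent (Real.exp_pos _).le zero_le_one).trans_eq (one_mul _)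

theorem gaussianPDFReal_le_exp_mul {s s' c : ℝ} (h : (s' ^ 2 - s ^ 2) / 2 ≤ c) :
    gaussianPDFReal 0 1 s ≤ Real.exp c * gaussianPDFReal 0 1 s' := by
  rw [gaussianPDFReal_zero_one, gaussianPDFReal_zero_one, mul_left_comm, ← Real.exp_add]
  gcongr
  linarith

theorem gaussianPDFReal_le_exp_seven_mul {b δ H s s' : ℝ} (hH0 : 0 < H) (hH : 2 / 3 ≤ H ^ 2)
    (hδH : δ ≤ 1 / H) (hb : -(2 * H) ≤ b) (hs : s ∈ Set.Icc b (b + δ))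
    (hs' : s' ∈ Set.Ico (b - 1 / H) b) :
    gaussianPDFReal 0 1 s ≤ Real.exp 7 * gaussianPDFReal 0 1 s' := by
  obtain ⟨⟨hs₁, hs₂⟩, hs'₁, hs'₂⟩ := And.intro hs hs'
  set w := 1 / H
  have : 0 < w := by positivity
  have width_mul : w * H = 1 := one_div_mul_cancel hH0.ne'
  have width_sq : w ^ 2 ≤ 3 / 2 := by
    rw [div_pow, one_pow, div_le_iff₀ (by positivity)]
    linarith
  refine gaussianPDFReal_le_exp_mul ?_
  have : (s - s') * (-(s + s')) ≤ 2 * w * (4 * H + 2 * w) := by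
    rcases le_or_gt (s + s') 0 with h | h
    · exact mul_le_mul (by linarith) (by linarith) (by linarith) (by positivity)
    · exact (mul_nonpos_of_nonneg_of_nonpos (by linarith) (by linarith)).trans (by positivity)
  nlinarith

/- The density on `[b, b + δ]` is compared with its average over the window `[b - 1 / H, b)`. -/
theorem gaussianReal_Icc_le_mul_Iio {b δ H : ℝ} (hδ : 0 ≤ δ) (hH0 : 0 < H) (hH : 2 / 3 ≤ H ^ 2)
    (hδH : δ ≤ 1 / H) (hb : -(2 * H) ≤ b) :
    gaussianReal 0 1 (Set.Icc b (b + δ)) ≤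
      ENNReal.ofReal (δ * (Real.exp 7 * H)) * gaussianReal 0 1 (Set.Iio b) := by
  set w := 1 / H
  have width_pos : 0 < w := by positivity
  have width_mul : w * H = 1 := one_div_mul_cancel hH0.ne'
  have average_le : ∀ s ∈ Set.Icc b (b + δ), gaussianPDFReal 0 1 s ≤
      (Real.exp 7 * H) * (gaussianReal 0 1).real (Set.Iio b) := by
    intro s hs
    have window : ∫ s' in Set.Ico (b - w) b, gaussianPDFReal 0 1 s' =
        (gaussianReal 0 1).real (Set.Ico (b - w) b) := by
      rw [measureReal_def, gaussianReal_apply_eq_integral _ one_ne_zero, ENNReal.toReal_ofReal]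
      exact integral_nonneg fun _ ↦ gaussianPDFReal_nonneg _ _ _
    have integrated : w * gaussianPDFReal 0 1 s ≤
        Real.exp 7 * (gaussianReal 0 1).real (Set.Ico (b - w) b) := by
      have := setIntegral_mono_on (integrableOn_const (by simp))
        ((integrable_gaussianPDFReal 0 1).const_mul _).integrableOn measurableSet_Ico
        fun s' hs' ↦ gaussianPDFReal_le_exp_seven_mul hH0 hH hδH hb hs hs'
      rwa [setIntegral_const, integral_const_mul, Real.volume_real_Ico_of_le (by linarith),
        window, sub_sub_cancel, smul_eq_mul] at this
    calc gaussianPDFReal 0 1 s = H * (w * gaussianPDFReal 0 1 s) := by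
          rw [← mul_assoc, mul_comm H, width_mul, one_mul]
      _ ≤ H * (Real.exp 7 * (gaussianReal 0 1).real (Set.Ico (b - w) b)) := by gcongr
      _ ≤ H * (Real.exp 7 * (gaussianReal 0 1).real (Set.Iio b)) := by
          have := measureReal_mono (μ := gaussianReal 0 1)
            (Set.Ico_subset_Iio_self (a := b - w) (b := b))
          gcongr
      _ = (Real.exp 7 * H) * (gaussianReal 0 1).real (Set.Iio b) := by ring
  refine (gaussianReal_Icc_le hδ average_le).trans_eq ?_
  rw [← mul_assoc, ENNReal.ofReal_mul (by positivity), ofReal_measureReal]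

section Shell

variable {E : Type*} [NormedAddCommGroup E] [InnerProductSpace ℝ E] {ι : Type*}

/-- The points at which the affine function `⟪u i, x⟫ + t i` is the smallest of its family, ties
being broken by the order of the indices. -/
def argminCell [LinearOrder ι] (u : ι → E) (t : ι → ℝ) (i : ι) : Set E :=
  {x | ∀ j, toLex (⟪u i, x⟫_ℝ + t i, i) ≤ toLex (⟪u j, x⟫_ℝ + t j, j)}

theorem exists_mem_argminCell [LinearOrder ι] [Finite ι] [Nonempty ι] (u : ι → E) (t : ι → ℝ)
    (x : E) : ∃ i, x ∈ argminCell u t i :=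
  Finite.exists_min fun i ↦ toLex (⟪u i, x⟫_ℝ + t i, i)

theorem pairwise_disjoint_argminCell [LinearOrder ι] (u : ι → E) (t : ι → ℝ) :
    Pairwise (Function.onFun Disjoint (argminCell u t)) := by
  intro i j hij
  refine Set.disjoint_left.2 fun x hi hj ↦ hij ?_
  exact congr_arg Prod.snd (toLex.injective ((hi j).antisymm (hj i)))

theorem add_mem_argminCell_of_le [LinearOrder ι] {u : ι → E} {t : ι → ℝ} (hu : ∀ i, ‖u i‖ = 1)
    {i : ι} {y : E} {r s : ℝ} (hrs : r ≤ s) (hs : s • u i + y ∈ argminCell u t i) :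
    r • u i + y ∈ argminCell u t i := by
  intro j
  have self_inner : ⟪u i, u i⟫_ℝ = 1 := by rw [real_inner_self_eq_norm_sq, hu i, one_pow]
  have inner_le : (s - r) * ⟪u j, u i⟫_ℝ ≤ (s - r) * 1 := by
    refine mul_le_mul_of_nonneg_left ((real_inner_le_norm _ _).trans ?_) (sub_nonneg.2 hrs)
    rw [hu i, hu j, one_mul]
  have h := hs j
  simp only [Prod.Lex.toLex_le_toLex, inner_add_right, inner_smul_right, self_inner] at h ⊢
  rcases h with h | ⟨h, h'⟩
  · left; linarith
  · rcases inner_le.lt_or_eq with lt | eq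
    · left; linarith
    · exact Or.inr ⟨by linarith, h'⟩

variable [FiniteDimensional ℝ E] [MeasurableSpace E] [BorelSpace E]

omit [FiniteDimensional ℝ E] in
theorem measurableSet_argminCell [LinearOrder ι] [Countable ι] (u : ι → E) (t : ι → ℝ) (i : ι) :
    MeasurableSet (argminCell u t i) := by
  have measurable_value (j : ι) : Measurable fun x ↦ ⟪u j, x⟫_ℝ + t j := by fun_prop
  simp only [argminCell, Prod.Lex.toLex_le_toLex, Set.ofPred_forall]
  refine MeasurableSet.iInter fun j ↦ ?_
  exact (measurableSet_lt (measurable_value i) (measurable_value j)).union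
    ((measurableSet_eq_fun (measurable_value i) (measurable_value j)).inter
      (MeasurableSet.const _))

theorem stdGaussian_eq_lintegral_lines {e : E} (he : ‖e‖ = 1) {B : Set E}
    (hB : MeasurableSet B) :
    stdGaussian E B = ∫⁻ y, gaussianReal 0 1 {s | s • e + y ∈ B}
      ∂((stdGaussian E).map fun x ↦ x - ⟪e, x⟫_ℝ • e) := by
  have recompose : Measurable fun p : ℝ × E ↦ p.1 • e + p.2 := by fun_prop
  have decompose : Measurable fun x : E ↦ (⟪e, x⟫_ℝ, x - ⟪e, x⟫_ℝ • e) := by fun_prop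
  have fubini := Measure.prod_apply_symm (μ := gaussianReal 0 1)
    (ν := (stdGaussian E).map fun x ↦ x - ⟪e, x⟫_ℝ • e) (recompose hB)
  rw [← stdGaussian_map_inner_prod_sub he, Measure.map_apply decompose (recompose hB)] at fubini
  simpa [Set.preimage_preimage] using! fubini

theorem ae_inner_eq_zero_map_sub {e : E} (he : ‖e‖ = 1) :
    ∀ᵐ y ∂((stdGaussian E).map fun x ↦ x - ⟪e, x⟫_ℝ • e), ⟪e, y⟫_ℝ = 0 := by
  rw [ae_map_iff (by fun_prop) (measurableSet_eq_fun (by fun_prop) measurable_const)]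
  refine ae_of_all _ fun x ↦ ?_
  simp [inner_sub_right, inner_smul_right, he]

theorem stdGaussian_slab_inter_le {e : E} (he : ‖e‖ = 1) {C : Set E} (hC : MeasurableSet C)
    (down : ∀ (y : E) (r s : ℝ), r ≤ s → s • e + y ∈ C → r • e + y ∈ C) {b δ H : ℝ}
    (hδ : 0 ≤ δ) (hH0 : 0 < H) (hH : 2 / 3 ≤ H ^ 2) (hδH : δ ≤ 1 / H) (hb : -(2 * H) ≤ b) :
    stdGaussian E (C ∩ {x | ⟪e, x⟫_ℝ ∈ Set.Icc b (b + δ)}) ≤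
      ENNReal.ofReal (δ * (Real.exp 7 * H)) * stdGaussian E C := by
  have slab : MeasurableSet {x : E | ⟪e, x⟫_ℝ ∈ Set.Icc b (b + δ)} :=
    measurableSet_Icc.preimage (by fun_prop)
  rw [stdGaussian_eq_lintegral_lines he (hC.inter slab), stdGaussian_eq_lintegral_lines he hC,
    ← lintegral_const_mul' _ _ ENNReal.ofReal_ne_top]
  refine lintegral_mono_ae ?_
  filter_upwards [ae_inner_eq_zero_map_sub he] with y hy
  have coordinate (s : ℝ) : ⟪e, s • e + y⟫_ℝ = s := by
    simp [inner_add_right, inner_smul_right, he, hy]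
  simp only [Set.mem_inter_iff, Set.mem_ofPred_eq, coordinate]
  rcases Set.eq_empty_or_nonempty {s : ℝ | s • e + y ∈ C ∧ s ∈ Set.Icc b (b + δ)} with
    empty | ⟨s, hsC, hs⟩
  · rw [empty, measure_empty]
    exact zero_le
  · calc gaussianReal 0 1 {s | s • e + y ∈ C ∧ s ∈ Set.Icc b (b + δ)}
        ≤ gaussianReal 0 1 (Set.Icc b (b + δ)) := measure_mono fun r hr ↦ hr.2
      _ ≤ ENNReal.ofReal (δ * (Real.exp 7 * H)) * gaussianReal 0 1 (Set.Iio b) :=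
          gaussianReal_Icc_le_mul_Iio hδ hH0 hH hδH hb
      _ ≤ ENNReal.ofReal (δ * (Real.exp 7 * H)) * gaussianReal 0 1 {s | s • e + y ∈ C} := by
          gcongr
          exact fun r (hr : r < b) ↦ down y r s (hr.le.trans hs.1) hsC

theorem stdGaussian_slab_le_of_tail {e : E} (he : ‖e‖ = 1) {b δ H : ℝ} (hδ : 0 ≤ δ)
    (hδH : δ ≤ H / 2) (hb : b < -(2 * H)) :
    stdGaussian E {x | ⟪e, x⟫_ℝ ∈ Set.Icc b (b + δ)} ≤
      ENNReal.ofReal (δ * Real.exp (-H ^ 2)) := by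
  refine le_of_eq_of_le ?_ (gaussianReal_Icc_le_of_tail hδ hδH hb)
  rw [← stdGaussian_map_inner he, Measure.map_apply (by fun_prop) measurableSet_Icc]
  rfl

theorem stdGaussian_argminCell_inter_slab_le [LinearOrder ι] [Countable ι] {u : ι → E}
    (hu : ∀ i, ‖u i‖ = 1) (t : ι → ℝ) {δ H : ℝ} (hδ : 0 ≤ δ) (hH0 : 0 < H) (hH : 2 / 3 ≤ H ^ 2)
    (hδ1 : δ ≤ H / 2) (hδ2 : δ ≤ 1 / H) (i : ι) :
    stdGaussian E (argminCell u t i ∩ {x | ⟪u i, x⟫_ℝ ∈ Set.Icc (-t i) (-t i + δ)}) ≤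
      ENNReal.ofReal (δ * (Real.exp 7 * H)) * stdGaussian E (argminCell u t i) +
        ENNReal.ofReal (δ * Real.exp (-H ^ 2)) := by
  rcases lt_or_ge (-t i) (-(2 * H)) with tail | bulk
  · exact le_add_left ((measure_mono Set.inter_subset_right).trans
      (stdGaussian_slab_le_of_tail (hu i) hδ hδ1 tail))
  · exact le_add_right (stdGaussian_slab_inter_le (hu i) (measurableSet_argminCell u t i)
      (fun _ _ _ ↦ add_mem_argminCell_of_le hu) hδ hH0 hH hδ2 bulk)

/-- Nazarov's inequality; `H² = log (n + 1)` gives the order `√(log n)` for `n` facets. -/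
theorem stdGaussian_shell_le [LinearOrder ι] [Fintype ι] {u : ι → E} (hu : ∀ i, ‖u i‖ = 1)
    (t : ι → ℝ) {δ H : ℝ} (hδ : 0 ≤ δ) (hH0 : 0 < H) (hH : 2 / 3 ≤ H ^ 2)
    (hι : Fintype.card ι ≤ Real.exp (H ^ 2)) (hδ1 : δ ≤ H / 2) (hδ2 : δ ≤ 1 / H) :
    stdGaussian E (polyhedron u t ∩ {x | ∃ i, ⟪u i, x⟫_ℝ + t i ≤ δ}) ≤
      ENNReal.ofReal (δ * ((Real.exp 7 + 2) * H)) := by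
  have cover : polyhedron u t ∩ {x | ∃ i, ⟪u i, x⟫_ℝ + t i ≤ δ} ⊆
      ⋃ i, argminCell u t i ∩ {x | ⟪u i, x⟫_ℝ ∈ Set.Icc (-t i) (-t i + δ)} := by
    rintro x ⟨hx, j, hj⟩
    have : Nonempty ι := ⟨j⟩
    obtain ⟨i, hi⟩ := exists_mem_argminCell u t x
    have smallest : ⟪u i, x⟫_ℝ + t i ≤ ⟪u j, x⟫_ℝ + t j :=
      (Prod.Lex.monotone_fst _ _ (hi j) :)
    exact Set.mem_iUnion.2 ⟨i, hi, by linarith [hx i], by linarith⟩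
  have cells : ∑ i, stdGaussian E (argminCell u t i) ≤ 1 := by
    rw [← tsum_fintype (L := .unconditional ι), ← measure_iUnion (pairwise_disjoint_argminCell u t)
      (measurableSet_argminCell u t)]
    exact prob_le_one
  have tails : Fintype.card ι * Real.exp (-H ^ 2) ≤ 2 * H := by
    rw [Real.exp_neg, ← div_eq_mul_inv]
    exact ((div_le_one (Real.exp_pos _)).2 hι).trans (by nlinarith)
  calc stdGaussian E (polyhedron u t ∩ {x | ∃ i, ⟪u i, x⟫_ℝ + t i ≤ δ})
      ≤ ∑ i, stdGaussian E
          (argminCell u t i ∩ {x | ⟪u i, x⟫_ℝ ∈ Set.Icc (-t i) (-t i + δ)}) :=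
        (measure_mono cover).trans (measure_iUnion_fintype_le _ _)
    _ ≤ ∑ i, (ENNReal.ofReal (δ * (Real.exp 7 * H)) * stdGaussian E (argminCell u t i) +
          ENNReal.ofReal (δ * Real.exp (-H ^ 2))) :=
        Finset.sum_le_sum fun i _ ↦
          stdGaussian_argminCell_inter_slab_le hu t hδ hH0 hH hδ1 hδ2 i
    _ = ENNReal.ofReal (δ * (Real.exp 7 * H)) * (∑ i, stdGaussian E (argminCell u t i)) +
          Fintype.card ι * ENNReal.ofReal (δ * Real.exp (-H ^ 2)) := by
        rw [Finset.sum_add_distrib, Finset.mul_sum, Finset.sum_const, nsmul_eq_mul,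
          Finset.card_univ]
    _ ≤ ENNReal.ofReal (δ * (Real.exp 7 * H)) * 1 +
          Fintype.card ι * ENNReal.ofReal (δ * Real.exp (-H ^ 2)) := by gcongr
    _ = ENNReal.ofReal (δ * (Real.exp 7 * H) + δ * (Fintype.card ι * Real.exp (-H ^ 2))) := by
        rw [mul_one, ENNReal.ofReal_add (by positivity) (by positivity),
          mul_left_comm δ (Fintype.card ι : ℝ),
          ENNReal.ofReal_mul (p := (Fintype.card ι : ℝ)) (by positivity),
          ENNReal.ofReal_natCast]
    _ ≤ ENNReal.ofReal (δ * ((Real.exp 7 + 2) * H)) :=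
        ENNReal.ofReal_le_ofReal (by nlinarith)

end Shell

theorem gaussianSurfaceArea_le_of_shell {d : ℕ} {A : Set (RSpace d)} {M δ₀ : ℝ} (hδ₀ : 0 < δ₀)
    (h : ∀ δ, 0 < δ → δ ≤ δ₀ →
      stdGaussian (RSpace d) (Metric.cthickening δ A \ A) ≤ ENNReal.ofReal (δ * M)) :
    gaussianSurfaceArea A ≤ ENNReal.ofReal M := by
  refine (liminf_le_liminf (v := fun _ ↦ ENNReal.ofReal M) ?_).trans_eq (by simp)
  have small : ∀ᶠ δ in 𝓝[>] (0 : ℝ), δ ∈ Set.Ioc 0 δ₀ := Ioc_mem_nhdsGT hδ₀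
  filter_upwards [small] with δ hδ
  refine ENNReal.div_le_of_le_mul ?_
  rw [mul_comm, ← ENNReal.ofReal_mul hδ.1.le]
  exact h δ hδ.1 hδ.2

section Boundary

variable {E : Type*} [NormedAddCommGroup E] [InnerProductSpace ℝ E] {ι : Type*}

theorem isClosed_polyhedron (u : ι → E) (t : ι → ℝ) : IsClosed (polyhedron u t) := by
  rw [polyhedron, Set.ofPred_forall]
  exact isClosed_iInter fun i ↦ isClosed_le continuous_const (by fun_prop)

theorem inner_le_inner_add_dist {e : E} (he : ‖e‖ = 1) (x y : E) :
    ⟪e, x⟫_ℝ ≤ ⟪e, y⟫_ℝ + dist x y := by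
  have := real_inner_le_norm e (x - y)
  rw [inner_sub_right, he, one_mul, ← dist_eq_norm] at this
  linarith

variable [ProperSpace E]

theorem cthickening_polyhedron_diff_subset {u : ι → E} (hu : ∀ i, ‖u i‖ = 1) (t : ι → ℝ) {δ : ℝ}
    (hδ : 0 ≤ δ) :
    Metric.cthickening δ (polyhedron u t) \ polyhedron u t ⊆
      polyhedron u (fun i ↦ t i + δ) ∩ {x | ∃ i, ⟪u i, x⟫_ℝ + (t i + δ) ≤ δ} := by
  rintro x ⟨hx, outside⟩
  rw [(isClosed_polyhedron u t).cthickening_eq_biUnion_closedBall hδ] at hx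
  simp only [Set.mem_iUnion, Metric.mem_closedBall'] at hx
  obtain ⟨a, ha, near⟩ := hx
  simp only [polyhedron, Set.mem_ofPred_eq, not_forall, not_le] at outside
  obtain ⟨i, hi⟩ := outside
  refine ⟨fun j ↦ ?_, i, by linarith⟩
  linarith [ha j, inner_le_inner_add_dist (hu j) a x]

theorem cthickening_compl_polyhedron_diff_subset [Finite ι] {u : ι → E} (hu : ∀ i, ‖u i‖ = 1)
    (t : ι → ℝ) {δ : ℝ} (hδ : 0 ≤ δ) :
    Metric.cthickening δ (polyhedron u t)ᶜ \ (polyhedron u t)ᶜ ⊆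
      polyhedron u t ∩ {x | ∃ i, ⟪u i, x⟫_ℝ + t i ≤ δ} := by
  rintro x ⟨hx, inside⟩
  refine ⟨not_not.1 inside, ?_⟩
  have closure_subset : closure (polyhedron u t)ᶜ ⊆ ⋃ i, {x | ⟪u i, x⟫_ℝ + t i ≤ 0} := by
    refine closure_minimal (fun z hz ↦ ?_)
      (isClosed_iUnion_of_finite fun i ↦ isClosed_le (by fun_prop) continuous_const)
    simp only [polyhedron, Set.mem_compl_iff, Set.mem_ofPred_eq, not_forall, not_le] at hz
    obtain ⟨i, hi⟩ := hz
    exact Set.mem_iUnion.2 ⟨i, hi.le⟩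
  rw [← Metric.cthickening_closure, isClosed_closure.cthickening_eq_biUnion_closedBall hδ] at hx
  simp only [Set.mem_iUnion, Metric.mem_closedBall] at hx
  obtain ⟨a, ha, near⟩ := hx
  obtain ⟨i, hi : ⟪u i, a⟫_ℝ + t i ≤ 0⟩ := Set.mem_iUnion.1 (closure_subset ha)
  exact ⟨i, by linarith [inner_le_inner_add_dist (hu i) x a]⟩

omit [ProperSpace E] in
theorem polyhedron_eq_normalized {a : ι → E} {b : ι → ℝ} (h : ∀ i, a i = 0 → 0 ≤ b i) :
    polyhedron a b = polyhedron (fun i : {i // a i ≠ 0} ↦ ‖a i‖⁻¹ • a i)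
      (fun i ↦ ‖a i‖⁻¹ * b i) := by
  ext x
  simp only [polyhedron, Set.mem_ofPred_eq, real_inner_smul_left, ← mul_add, Subtype.forall]
  refine forall_congr' fun i ↦ ?_
  by_cases hi : a i = 0
  · simp [hi, h i hi]
  · simp [hi, mul_nonneg_iff_of_pos_left (inv_pos.2 (norm_pos_iff.2 hi))]

end Boundary

theorem gaussianSurfaceArea_polyhedron_le_of_norm_eq_one {d : ℕ} {ι : Type*} [LinearOrder ι]
    [Fintype ι] {u : ι → RSpace d} (hu : ∀ i, ‖u i‖ = 1) (t : ι → ℝ) {H : ℝ} (hH0 : 0 < H)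
    (hH : 2 / 3 ≤ H ^ 2) (hι : Fintype.card ι ≤ Real.exp (H ^ 2)) :
    gaussianSurfaceArea (polyhedron u t) ≤ ENNReal.ofReal ((Real.exp 7 + 2) * H) ∧
      gaussianSurfaceArea (polyhedron u t)ᶜ ≤ ENNReal.ofReal ((Real.exp 7 + 2) * H) := by
  have pos : 0 < min (H / 2) (1 / H) := by positivity
  constructor <;> refine gaussianSurfaceArea_le_of_shell pos fun δ hδ hδ₀ ↦ ?_
  · exact (measure_mono (cthickening_polyhedron_diff_subset hu t hδ.le)).trans
      (stdGaussian_shell_le hu _ hδ.le hH0 hH hι (le_min_iff.1 hδ₀).1 (le_min_iff.1 hδ₀).2)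
  · exact (measure_mono (cthickening_compl_polyhedron_diff_subset hu t hδ.le)).trans
      (stdGaussian_shell_le hu t hδ.le hH0 hH hι (le_min_iff.1 hδ₀).1 (le_min_iff.1 hδ₀).2)

theorem gaussianSurfaceArea_polyhedron_le {d K : ℕ} (hK : 0 < K) (w : Fin K → RSpace d)
    (t : Fin K → ℝ) :
    gaussianSurfaceArea (polyhedron w t) ≤
        ENNReal.ofReal ((Real.exp 7 + 2) * √(Real.log (K + 1))) ∧
      gaussianSurfaceArea (polyhedron w t)ᶜ ≤
        ENNReal.ofReal ((Real.exp 7 + 2) * √(Real.log (K + 1))) := by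
  by_cases consistent : ∀ i, w i = 0 → 0 ≤ t i
  · have one_le : (1 : ℝ) ≤ K := Nat.one_le_cast.2 hK
    have log_ge : 2 / 3 ≤ Real.log (K + 1) := by
      have : Real.log 2 ≤ Real.log (K + 1) := Real.log_le_log two_pos (by linarith)
      linarith [Real.log_two_gt_d9]
    rw [polyhedron_eq_normalized consistent]
    refine gaussianSurfaceArea_polyhedron_le_of_norm_eq_one
      (fun i ↦ norm_smul_inv_norm (𝕜 := ℝ) i.2) _ (by positivity) ?_ ?_
    · rwa [Real.sq_sqrt (by linarith)]
    · rw [Real.sq_sqrt (by linarith), Real.exp_log (by linarith)]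
      have : Fintype.card {i // w i ≠ 0} ≤ K :=
        (Fintype.card_subtype_le _).trans_eq (Fintype.card_fin K)
      have : (Fintype.card {i // w i ≠ 0} : ℝ) ≤ K := Nat.cast_le.2 this
      linarith
  · push Not at consistent
    obtain ⟨i, hi, ht⟩ := consistent
    have empty : polyhedron w t = ∅ := by
      refine Set.eq_empty_of_forall_notMem fun x hx ↦ ?_
      have := hx i
      rw [hi, inner_zero_left, zero_add] at this
      exact ht.not_ge this
    simp [empty, gaussianSurfaceArea]

end SurfaceArea

section HermiteQuadratic

/-- The combination `a He₁ - b He₂` of the Hermite polynomials of degree one and two, i.e. the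
general quadratic of mean zero under the standard Gaussian. -/
def hermiteQuadratic (a b s : ℝ) : ℝ := a * s + b * (1 - s ^ 2)

theorem measurable_hermiteQuadratic (a b : ℝ) : Measurable (hermiteQuadratic a b) := by
  unfold hermiteQuadratic
  fun_prop

theorem abs_hermiteQuadratic_le (a b s : ℝ) :
    |hermiteQuadratic a b s| ≤ |a| * |s| + |b| * (1 + s ^ 2) := by
  refine (abs_add_le _ _).trans ?_
  rw [abs_mul, abs_mul]
  gcongr
  exact (abs_sub _ _).trans_eq (by rw [abs_one, abs_sq])

theorem integrable_hermiteQuadratic (a b : ℝ) :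
    Integrable (hermiteQuadratic a b) (gaussianReal 0 1) :=
  (integrable_id_gaussianReal.const_mul a).add
    (((integrable_const 1).sub (integrable_pow_gaussianReal 2)).const_mul b)

theorem integral_hermiteQuadratic (a b : ℝ) :
    ∫ s, hermiteQuadratic a b s ∂(gaussianReal 0 1) = 0 := by
  have centred : Integrable (fun s : ℝ ↦ 1 - s ^ 2) (gaussianReal 0 1) :=
    (integrable_const 1).sub (integrable_pow_gaussianReal 2)
  simp only [hermiteQuadratic]
  rw [integral_add (integrable_id_gaussianReal.const_mul a) (centred.const_mul b),
    integral_const_mul, integral_const_mul,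
    integral_sub (integrable_const 1) (integrable_pow_gaussianReal 2),
    integral_id_gaussianReal, integral_sq_gaussianReal]
  simp

theorem integral_pow_three_gaussianReal : ∫ s, s ^ 3 ∂(gaussianReal 0 1) = 0 := by
  have symmetric : ∫ s, s ^ 3 ∂(gaussianReal 0 1) = ∫ s, (-s) ^ 3 ∂(gaussianReal 0 1) := by
    conv_lhs => rw [← neg_zero, ← gaussianReal_map_neg]
    exact integral_map (by fun_prop) (by fun_prop)
  simp only [Odd.neg_pow (by decide : Odd 3), integral_neg] at symmetric
  linarith

theorem integral_hermiteQuadratic_sq (a b : ℝ) :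
    ∫ s, hermiteQuadratic a b s ^ 2 ∂(gaussianReal 0 1) = a ^ 2 + 2 * b ^ 2 := by
  have expand (s : ℝ) : hermiteQuadratic a b s ^ 2 =
      b ^ 2 + 2 * a * b * s + (a ^ 2 - 2 * b ^ 2) * s ^ 2 + -(2 * a * b) * s ^ 3 +
        b ^ 2 * s ^ 4 := by
    rw [hermiteQuadratic]
    ring
  have int (n : ℕ) (c : ℝ) : Integrable (fun s ↦ c * s ^ n) (gaussianReal 0 1) :=
    (integrable_pow_gaussianReal n).const_mul c
  have int_one : Integrable (fun s ↦ b ^ 2 + 2 * a * b * s) (gaussianReal 0 1) :=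
    (integrable_const _).add (integrable_id_gaussianReal.const_mul _)
  have int_two := int_one.fun_add (int 2 (a ^ 2 - 2 * b ^ 2))
  have int_three := int_two.fun_add (int 3 (-(2 * a * b)))
  simp only [expand]
  rw [integral_add int_three (int 4 _), integral_add int_two (int 3 _),
    integral_add int_one (int 2 _),
    integral_add (integrable_const _) (integrable_id_gaussianReal.const_mul _),
    integral_const_mul (2 * a * b), integral_id_gaussianReal]
  simp only [integral_const_mul, integral_const, probReal_univ, smul_eq_mul, one_mul,
    integral_sq_gaussianReal, integral_pow_three_gaussianReal, integral_pow_four_gaussianReal]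
  ring

end HermiteQuadratic

section NoiseLevel

/-- The quantity `L p + ζ` with `L = log (1 / ζ + 1)`. Up to a constant it bounds the second moment
of a standard Gaussian over any event of probability `p`. The free parameter `ζ > 0` is a cut-off:
the bound is of the optimal order when `ζ` is of the order of `p`. -/
noncomputable def noiseLevel (ζ p : ℝ) : ℝ := Real.log (1 / ζ + 1) * p + ζ

variable {ζ p : ℝ}

theorem noiseLevel_pos (hζ : 0 < ζ) (hζ1 : ζ ≤ 1) (hp : 0 ≤ p) : 0 < noiseLevel ζ p := by
  have := two_thirds_le_log_one_div_add_one hζ hζ1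
  unfold noiseLevel
  positivity

theorem le_noiseLevel (hζ : 0 < ζ) (hζ1 : ζ ≤ 1) (hp : 0 ≤ p) : ζ ≤ noiseLevel ζ p := by
  have := two_thirds_le_log_one_div_add_one hζ hζ1
  exact le_add_of_nonneg_left (mul_nonneg (by linarith) hp)

theorem le_three_halves_mul_noiseLevel (hζ : 0 < ζ) (hζ1 : ζ ≤ 1) (hp : 0 ≤ p) :
    p ≤ 3 / 2 * noiseLevel ζ p := by
  have := mul_le_mul_of_nonneg_right (two_thirds_le_log_one_div_add_one hζ hζ1) hp
  unfold noiseLevel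
  linarith

variable {Ω : Type*} [MeasurableSpace Ω] {Q : Measure Ω} {s : Ω → ℝ}

theorem setIntegral_sq_le_noiseLevel (hs : HasLaw s (gaussianReal 0 1) Q) (B : Set Ω)
    (hζ : 0 < ζ) : ∫ ω in B, s ω ^ 2 ∂Q ≤ 6 * noiseLevel ζ (Q.real B) := by
  have := hs.isProbabilityMeasure
  set L := Real.log (1 / ζ + 1) with hL
  have L_nonneg : 0 ≤ L := Real.log_nonneg (by simp [hζ.le])
  have exp_neg_le : Real.exp (-L) ≤ ζ := by
    rw [Real.exp_neg, Real.exp_log (by positivity), inv_le_comm₀ (by positivity) hζ, one_div]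
    linarith
  have young (t : ℝ) : t ^ 2 ≤ 4 * L + 4 * Real.exp (-L) * Real.exp (t ^ 2 / 4) := by
    rw [mul_assoc, ← Real.exp_add]
    linarith [Real.add_one_le_exp (-L + t ^ 2 / 4)]
  have int_exp : Integrable (fun ω ↦ Real.exp (s ω ^ 2 / 4)) Q :=
    (hs.map_eq ▸ integrable_exp_sq_div_four_gaussianReal).comp_aemeasurable hs.aemeasurable
  have exp_le : ∫ ω in B, Real.exp (s ω ^ 2 / 4) ∂Q ≤ √2 :=
    (setIntegral_le_integral int_exp (ae_of_all _ fun _ ↦ (Real.exp_pos _).le)).trans_eq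
      ((hs.integral_comp (f := fun t ↦ Real.exp (t ^ 2 / 4)) (by fun_prop)).trans
        integral_exp_sq_div_four_gaussianReal)
  have sqrt_two_le : √2 ≤ 3 / 2 := Real.sqrt_le_iff.2 (by norm_num)
  have int_sq : Integrable (fun ω ↦ s ω ^ 2) Q :=
    (hs.map_eq ▸ integrable_pow_gaussianReal 2).comp_aemeasurable hs.aemeasurable
  calc ∫ ω in B, s ω ^ 2 ∂Q
      ≤ ∫ ω in B, (4 * L + 4 * Real.exp (-L) * Real.exp (s ω ^ 2 / 4)) ∂Q :=
        integral_mono int_sq.integrableOn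
          ((integrable_const _).add (int_exp.integrableOn.const_mul _)) fun ω ↦ young (s ω)
    _ = 4 * (L * Q.real B) + 4 * Real.exp (-L) * ∫ ω in B, Real.exp (s ω ^ 2 / 4) ∂Q := by
        rw [integral_add (integrable_const _) (int_exp.integrableOn.const_mul _),
          integral_const_mul (4 * Real.exp (-L)), setIntegral_const, smul_eq_mul]
        ring
    _ ≤ 4 * (L * Q.real B) + 4 * ζ * (3 / 2) := by
        gcongr
        exact exp_le.trans sqrt_two_le
    _ ≤ 6 * noiseLevel ζ (Q.real B) := by
        rw [noiseLevel, ← hL]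
        linarith [mul_nonneg L_nonneg (measureReal_nonneg (μ := Q) (s := B))]

theorem setIntegral_abs_le_noiseLevel (hs : HasLaw s (gaussianReal 0 1) Q) (B : Set Ω)
    (hζ : 0 < ζ) :
    ∫ ω in B, |s ω| ∂Q ≤ 4 * (noiseLevel ζ (Q.real B) / √(Real.log (1 / ζ + 1))) := by
  have := hs.isProbabilityMeasure
  have L_pos : 0 < Real.log (1 / ζ + 1) := Real.log_pos (by simp [hζ])
  have sq_bound := setIntegral_sq_le_noiseLevel hs B hζ
  set N := noiseLevel ζ (Q.real B) with hN
  set r := √(Real.log (1 / ζ + 1))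
  have : 0 < r := Real.sqrt_pos.2 L_pos
  have r_sq : r ^ 2 = Real.log (1 / ζ + 1) := Real.sq_sqrt L_pos.le
  have young (t : ℝ) : |t| ≤ (2 * r)⁻¹ * (r ^ 2 + t ^ 2) := by
    rw [inv_mul_eq_div, le_div_iff₀ (by positivity), ← sq_abs t]
    linarith [two_mul_le_add_sq r |t|]
  have int_abs : Integrable (fun ω ↦ |s ω|) Q :=
    (hs.map_eq ▸ integrable_id_gaussianReal.abs).comp_aemeasurable hs.aemeasurable
  have int_sq : Integrable (fun ω ↦ s ω ^ 2) Q :=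
    (hs.map_eq ▸ integrable_pow_gaussianReal 2).comp_aemeasurable hs.aemeasurable
  calc ∫ ω in B, |s ω| ∂Q ≤ ∫ ω in B, (2 * r)⁻¹ * (r ^ 2 + s ω ^ 2) ∂Q :=
        integral_mono int_abs.integrableOn
          (((integrable_const _).add int_sq.integrableOn).const_mul _) fun ω ↦ young (s ω)
    _ = (2 * r)⁻¹ * (r ^ 2 * Q.real B + ∫ ω in B, s ω ^ 2 ∂Q) := by
        rw [integral_const_mul, integral_add (integrable_const _) int_sq.integrableOn,
          setIntegral_const, smul_eq_mul, mul_comm (Q.real B)]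
    _ ≤ (2 * r)⁻¹ * (N + 6 * N) := by
        gcongr
        rw [r_sq, hN, noiseLevel]
        linarith
    _ = 7 / 2 * (N / r) := by ring
    _ ≤ 4 * (N / r) := by
        have : 0 ≤ N := by rw [hN, noiseLevel]; positivity
        gcongr
        norm_num

theorem setIntegral_abs_hermiteQuadratic_le (hs : HasLaw s (gaussianReal 0 1) Q) (B : Set Ω)
    (hζ : 0 < ζ) (hζ1 : ζ ≤ 1) (a b : ℝ) :
    ∫ ω in B, |hermiteQuadratic a b (s ω)| ∂Q ≤
      8 * (|a| / √(Real.log (1 / ζ + 1)) + |b|) * noiseLevel ζ (Q.real B) := by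
  have := hs.isProbabilityMeasure
  have int {g : ℝ → ℝ} (hg : Integrable g (gaussianReal 0 1)) :
      IntegrableOn (fun ω ↦ g (s ω)) B Q :=
    ((hs.map_eq ▸ hg).comp_aemeasurable hs.aemeasurable).integrableOn
  have int_abs := (int integrable_id_gaussianReal.abs).const_mul |a|
  have int_one_add_sq := (integrable_const (1 : ℝ)).fun_add (int (integrable_pow_gaussianReal 2))
  have mass_nonneg : 0 ≤ Q.real B := measureReal_nonneg
  have mass_le := le_three_halves_mul_noiseLevel hζ hζ1 mass_nonneg
  have N_pos := noiseLevel_pos hζ hζ1 mass_nonneg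
  calc ∫ ω in B, |hermiteQuadratic a b (s ω)| ∂Q
      ≤ ∫ ω in B, (|a| * |s ω| + |b| * (1 + s ω ^ 2)) ∂Q :=
        integral_mono (int (integrable_hermiteQuadratic a b).abs)
          (int_abs.add (int_one_add_sq.const_mul |b|)) fun ω ↦ abs_hermiteQuadratic_le a b (s ω)
    _ = |a| * ∫ ω in B, |s ω| ∂Q + |b| * (Q.real B + ∫ ω in B, s ω ^ 2 ∂Q) := by
        rw [integral_add int_abs (int_one_add_sq.const_mul |b|), integral_const_mul,
          integral_const_mul,
          integral_add (integrable_const 1) (int (integrable_pow_gaussianReal 2)),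
          setIntegral_one_eq_measureReal]
    _ ≤ |a| * (8 * (noiseLevel ζ (Q.real B) / √(Real.log (1 / ζ + 1)))) +
          |b| * (8 * noiseLevel ζ (Q.real B)) := by
        gcongr
        · refine (setIntegral_abs_le_noiseLevel hs B hζ).trans ?_
          gcongr
          norm_num
        · linarith [setIntegral_sq_le_noiseLevel hs B hζ]
    _ = 8 * (|a| / √(Real.log (1 / ζ + 1)) + |b|) * noiseLevel ζ (Q.real B) := by ring

end NoiseLevel

section Correlation

theorem exists_convex_quadratic_correlation : ∃ c : ℝ, 0 < c ∧ ∀ (E : Type*)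
    [NormedAddCommGroup E] [InnerProductSpace ℝ E] [FiniteDimensional ℝ E]
    [MeasurableSpace E] [BorelSpace E] (A : Set E) (e : E) (T ζ : ℝ), Convex ℝ A →
      MeasurableSet A → ‖e‖ = 1 → (∀ x ∈ A, -T ≤ ⟪e, x⟫_ℝ) → 0 < (stdGaussian E).real A →
      0 < ζ → ζ ≤ 1 → ζ ≤ gaussianTail T →
      |⨍ x in A, ⟪e, x⟫_ℝ ∂(stdGaussian E)| ≤ 1 / √(Real.log (1 / ζ + 1)) →
        c * ((stdGaussian E).real A * gaussianTail T) ≤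
          ∫ x in A, hermiteQuadratic (⨍ y in A, ⟪e, y⟫_ℝ ∂(stdGaussian E)) 1 ⟪e, x⟫_ℝ
            ∂(stdGaussian E) := by
  obtain ⟨c₁, hc₁, contraction⟩ := exists_convex_contraction
  obtain ⟨c₂, hc₂, tail_shift⟩ := exists_mul_gaussianTail_le_of_abs_le
  refine ⟨c₁ * c₂, by positivity, fun E _ _ _ _ _ A e T ζ hA hm he hT pos hζ hζ1 hζT small ↦ ?_⟩
  set γ := stdGaussian E
  set μ := ⨍ x in A, ⟪e, x⟫_ℝ ∂γ
  calc c₁ * c₂ * (γ.real A * gaussianTail T) = c₁ * γ.real A * (c₂ * gaussianTail T) := by ring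
    _ ≤ c₁ * γ.real A * gaussianTail (T + μ) := by
        gcongr
        exact tail_shift T μ ζ hζ hζ1 hζT small
    _ ≤ ∫ x in A, (1 - ⟪e, x⟫_ℝ ^ 2 + μ * ⟪e, x⟫_ℝ) ∂γ := contraction E A e T hA hm he hT pos
    _ = ∫ x in A, hermiteQuadratic μ 1 ⟪e, x⟫_ℝ ∂γ := by
        simp only [hermiteQuadratic, one_mul, add_comm]

theorem setIntegral_hermiteQuadratic_sign {Ω : Type*} [MeasurableSpace Ω] {P : Measure Ω}
    [IsFiniteMeasure P] (s : Ω → ℝ) (A : Set Ω) :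
    ∫ ω in A, hermiteQuadratic (SignType.sign (⨍ ω in A, s ω ∂P)) 0 (s ω) ∂P =
      P.real A * |⨍ ω in A, s ω ∂P| := by
  simp only [hermiteQuadratic, zero_mul, add_zero]
  rw [integral_const_mul, ← measure_smul_setAverage s (measure_ne_top P A), smul_eq_mul,
    mul_left_comm, sign_mul_self]

theorem sqrt_le_one_div_sqrt_log {z : ℝ} (hz : 0 < z) : √z ≤ 1 / √(Real.log (1 / z + 1)) := by
  have log_pos : 0 < Real.log (1 / z + 1) := Real.log_pos (by simp [hz])
  rw [le_div_iff₀ (Real.sqrt_pos.2 log_pos), ← Real.sqrt_mul hz.le, Real.sqrt_le_one,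
    ← le_div_iff₀' hz]
  linarith [Real.log_le_sub_one_of_pos (by positivity : 0 < 1 / z + 1)]

theorem one_div_sqrt_log_sq_le {z : ℝ} (hz : 0 < z) (hz1 : z ≤ 1) :
    (1 / √(Real.log (1 / z + 1))) ^ 2 ≤ 3 / 2 := by
  have log_ge := two_thirds_le_log_one_div_add_one hz hz1
  rw [div_pow, one_pow, Real.sq_sqrt (by linarith), div_le_iff₀ (by linarith)]
  linarith

theorem half_min_le_mul_one_sub {x : ℝ} (h0 : 0 ≤ x) (h1 : x ≤ 1) :
    min x (1 - x) / 2 ≤ x * (1 - x) := by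
  rcases min_cases x (1 - x) with ⟨h, h'⟩ | ⟨h, h'⟩ <;> rw [h] <;> nlinarith

theorem exists_linear_correlation {Ω : Type*} [MeasurableSpace Ω] {P : Measure Ω}
    [IsFiniteMeasure P] {s : Ω → ℝ} {A : Set Ω} {C c K N ε ζ : ℝ} (hC : 8 ≤ C) (hc1 : c ≤ 1)
    (hK : 1 ≤ K) (hN : 0 ≤ N) (hε : 0 ≤ ε) (hζ : 0 < ζ) (gap : C * K * N + ε < P.real A)
    (large : 1 / √(Real.log (1 / ζ + 1)) < |⨍ ω in A, s ω ∂P|) :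
    ∃ a b : ℝ, a ^ 2 + 2 * b ^ 2 ≤ 4 ∧
      c * (ε / K) * √ζ + 8 * (|a| / √(Real.log (1 / ζ + 1)) + |b|) * N <
        ∫ ω in A, hermiteQuadratic a b (s ω) ∂P := by
  set μ := ⨍ ω in A, s ω ∂P with hμ
  set r := 1 / √(Real.log (1 / ζ + 1)) with hr
  have sqrt_le : √ζ ≤ r := sqrt_le_one_div_sqrt_log hζ
  have abs_mean_pos : 0 < |μ| := (sqrt_le.trans_lt large).trans_le' (Real.sqrt_nonneg _)
  have abs_sign : |(SignType.sign μ : ℝ)| = 1 := by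
    rcases (abs_pos.1 abs_mean_pos).lt_or_gt with h | h <;> simp [h]
  refine ⟨SignType.sign μ, 0, by rw [← sq_abs, abs_sign]; norm_num, ?_⟩
  rw [hμ, setIntegral_hermiteQuadratic_sign, ← hμ, abs_sign, abs_zero, add_zero, ← hr]
  calc c * (ε / K) * √ζ + 8 * r * N ≤ 1 * ε * r + C * K * r * N := by
        gcongr
        · exact div_le_self hε hK
        · nlinarith
    _ = (C * K * N + ε) * r := by ring
    _ ≤ (C * K * N + ε) * |μ| := by gcongr
    _ < P.real A * |μ| := by gcongr

theorem neg_div_norm_le_inner {E ι : Type*} [NormedAddCommGroup E] [InnerProductSpace ℝ E]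
    {w : ι → E} {t : ι → ℝ} {x : E} (hx : x ∈ polyhedron w t) (i : ι) :
    -(t i / ‖w i‖) ≤ ⟪‖w i‖⁻¹ • w i, x⟫_ℝ := by
  rw [real_inner_smul_left, inv_mul_eq_div, ← neg_div]
  gcongr
  linarith [hx i]

theorem lt_mul_mass_mul_tail {c C K N ε ζ β μ ρ : ℝ} (hc : 0 < c) (hK : 1 ≤ K) (hN : 0 < N)
    (hε : 0 ≤ ε) (hC : 40 ≤ c * C) (hζ : 0 < ζ) (hζ1 : ζ ≤ 1) (hβ : 0 ≤ β) (hβ1 : β ≤ 1)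
    (gap : C * K * N + ε < min β (1 - β)) (small : |μ| ≤ 1 / √(Real.log (1 / ζ + 1)))
    (hρ : (1 - β) / K ≤ ρ) :
    c / 2 * (ε / K) * √ζ + 8 * (|μ| / √(Real.log (1 / ζ + 1)) + 1) * N < c * (β * ρ) := by
  set L := Real.log (1 / ζ + 1)
  have cost_le : |μ| / √L ≤ 3 / 2 := by
    calc |μ| / √L ≤ 1 / √L / √L := by gcongr
      _ = (1 / √L) ^ 2 := by ring
      _ ≤ 3 / 2 := one_div_sqrt_log_sq_le hζ hζ1
  have half_gap_lt := div_lt_div_of_pos_right gap two_pos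
  calc c / 2 * (ε / K) * √ζ + 8 * (|μ| / √L + 1) * N
      ≤ c / 2 * (ε / K) * 1 + 8 * (3 / 2 + 1) * N := by
        gcongr
        exact Real.sqrt_le_one.2 hζ1
    _ ≤ c / 2 * (ε / K) * 1 + c * C / 2 * N := by
        gcongr
        linarith
    _ = c * ((C * K * N + ε) / 2 / K) := by field_simp; ring
    _ < c * (β * (1 - β) / K) := by
        gcongr
        exact half_gap_lt.trans_le (half_min_le_mul_one_sub hβ hβ1)
    _ = c * (β * ((1 - β) / K)) := by rw [mul_div_assoc]
    _ ≤ c * (β * ρ) := by gcongr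

/-- If the mean of the polyhedron along the normal of the facet is small, contraction of the
variance makes a quadratic correlate with it; if it is large, a linear function does. -/
theorem exists_quadratic_correlation : ∃ C c : ℝ, 1 ≤ C ∧ 0 < c ∧ c ≤ 1 ∧ ∀ (E : Type*)
    [NormedAddCommGroup E] [InnerProductSpace ℝ E] [FiniteDimensional ℝ E]
    [MeasurableSpace E] [BorelSpace E] (ι : Type*) [Fintype ι] (w : ι → E) (t : ι → ℝ)
    (ζ p ε : ℝ), 0 < ζ → ζ ≤ 1 → 0 ≤ p → 0 ≤ ε →
      C * Fintype.card ι * noiseLevel ζ p + ε <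
        min ((stdGaussian E).real (polyhedron w t)) (1 - (stdGaussian E).real (polyhedron w t)) →
      ∃ i, w i ≠ 0 ∧ ∃ a b : ℝ, a ^ 2 + 2 * b ^ 2 ≤ 4 ∧
        c * (ε / Fintype.card ι) * √ζ +
            8 * (|a| / √(Real.log (1 / ζ + 1)) + |b|) * noiseLevel ζ p <
          ∫ x in polyhedron w t, hermiteQuadratic a b ⟪‖w i‖⁻¹ • w i, x⟫_ℝ ∂(stdGaussian E) := by
  obtain ⟨c₀, hc₀, correlation⟩ := exists_convex_quadratic_correlation
  refine ⟨max 8 (40 / c₀), min (c₀ / 2) 1, le_max_of_le_left (by norm_num),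
    lt_min (by positivity) one_pos, min_le_right _ _,
    fun E _ _ _ _ _ ι _ w t ζ p ε hζ hζ1 hp hε gap ↦ ?_⟩
  set C := max 8 (40 / c₀)
  set c := min (c₀ / 2) 1
  set P := polyhedron w t
  set β := (stdGaussian E).real P
  set N := noiseLevel ζ p
  set K := (Fintype.card ι : ℝ)
  set L := Real.log (1 / ζ + 1)
  have N_pos : 0 < N := noiseLevel_pos hζ hζ1 hp
  have gap_nonneg : 0 ≤ C * K * N + ε := by positivity
  have forty_le : 40 ≤ c₀ * C := (div_le_iff₀' hc₀).1 (le_max_right _ _)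
  have lt_mass := gap.trans_le (min_le_left _ _)
  have lt_co_mass := gap.trans_le (min_le_right _ _)
  obtain ⟨i, normal_ne, le_tail⟩ := exists_facet (by linarith : 0 < β) (by linarith : β < 1)
  have card_ge : 1 ≤ K := Nat.one_le_cast.2 (Fintype.card_pos_iff.2 ⟨i⟩)
  refine ⟨i, normal_ne, ?_⟩
  set e := ‖w i‖⁻¹ • w i
  set μ := ⨍ x in P, ⟪e, x⟫_ℝ ∂(stdGaussian E)
  rcases le_or_gt |μ| (1 / √L) with small | large
  · have cutoff_le_tail : ζ ≤ gaussianTail (t i / ‖w i‖) := by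
      refine (le_noiseLevel hζ hζ1 hp).trans (le_trans ?_ le_tail)
      have eight_le : 8 ≤ C := le_max_left _ _
      rw [le_div_iff₀ (by linarith)]
      nlinarith
    refine ⟨μ, 1, by linarith [sq_le_sq' (abs_le.1 small).1 (abs_le.1 small).2,
      one_div_sqrt_log_sq_le hζ hζ1], ?_⟩
    calc c * (ε / K) * √ζ + 8 * (|μ| / √L + |1|) * N
        ≤ c₀ / 2 * (ε / K) * √ζ + 8 * (|μ| / √L + 1) * N := by
          rw [abs_one]
          gcongr
          exact min_le_left _ _
      _ < c₀ * (β * gaussianTail (t i / ‖w i‖)) :=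
          lt_mul_mass_mul_tail hc₀ card_ge N_pos hε forty_le hζ hζ1 measureReal_nonneg
            measureReal_le_one gap small le_tail
      _ ≤ _ := correlation E P e _ ζ (convex_polyhedron w t) (measurableSet_polyhedron w t)
          (norm_smul_inv_norm (𝕜 := ℝ) normal_ne) (fun x hx ↦ neg_div_norm_le_inner hx i)
          (by linarith) hζ hζ1 cutoff_le_tail small
  · exact exists_linear_correlation (le_max_left _ _) (min_le_right _ _) card_ge N_pos.le hε hζ
      lt_mass large

end Correlation

section NoiseRate

variable {ζ p r : ℝ}

theorem sq_mul_log_one_div_sq_add_one_le (hr : 0 < r) :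
    r ^ 2 * Real.log (1 / r ^ 2 + 1) ≤ 2 * r := by
  have log_le : Real.log (1 / r ^ 2 + 1) ≤ 2 * (1 / r) := by
    calc Real.log (1 / r ^ 2 + 1) ≤ Real.log ((1 / r + 1) ^ 2) := by
          gcongr
          linarith [show 0 ≤ 2 * (1 / r) by positivity,
            show (1 / r + 1) ^ 2 = 1 / r ^ 2 + 2 * (1 / r) + 1 by ring]
      _ = 2 * Real.log (1 / r + 1) := mod_cast Real.log_pow _ 2
      _ ≤ 2 * (1 / r) := by
          gcongr
          linarith [Real.log_le_sub_one_of_pos (by positivity : 0 < 1 / r + 1)]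
  calc r ^ 2 * Real.log (1 / r ^ 2 + 1) ≤ r ^ 2 * (2 * (1 / r)) := by gcongr
    _ = 2 * r := by field_simp

theorem noiseLevel_le_of_le (hζ : 0 < ζ) (hζ1 : ζ ≤ 1) (hp : p ≤ ζ) :
    noiseLevel ζ p ≤ 5 / 2 * (ζ * Real.log (1 / ζ + 1)) := by
  have log_ge := two_thirds_le_log_one_div_add_one hζ hζ1
  rw [noiseLevel]
  nlinarith

theorem noiseLevel_max_le (hζ : 0 < ζ) (hζ1 : ζ ≤ 1) (hr : 0 < r) (hr1 : r ≤ 1) :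
    noiseLevel (max ζ (r ^ 2)) ζ ≤ 5 / 2 * (ζ * Real.log (1 / ζ + 1)) + 5 * r := by
  rcases le_total (r ^ 2) ζ with h | h
  · rw [max_eq_left h]
    linarith [noiseLevel_le_of_le hζ hζ1 le_rfl]
  · rw [max_eq_right h]
    have log_nonneg : 0 ≤ Real.log (1 / ζ + 1) := Real.log_nonneg (by simp [hζ.le])
    linarith [noiseLevel_le_of_le (by positivity) (pow_le_one₀ hr.le hr1) h,
      sq_mul_log_one_div_sq_add_one_le hr, mul_nonneg hζ.le log_nonneg]

end NoiseRate

theorem preimage_add_starProjection_polyhedron {E ι : Type*} [NormedAddCommGroup E]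
    [InnerProductSpace ℝ E] [FiniteDimensional ℝ E] (V : Submodule ℝ E) (w : ι → E) (t : ι → ℝ)
    (v : V) :
    (fun x ↦ (v : E) + Vᗮ.starProjection x) ⁻¹' polyhedron w t =
      polyhedron (fun i ↦ Vᗮ.starProjection (w i)) fun i ↦ t i + ⟪w i, v⟫_ℝ := by
  ext x
  simp only [polyhedron, Set.mem_preimage, Set.mem_ofPred_eq, inner_add_right,
    Submodule.inner_starProjection_left_eq_right, add_assoc, add_comm]

theorem inner_starProjection_of_mem {E : Type*} [NormedAddCommGroup E] [InnerProductSpace ℝ E]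
    {U : Submodule ℝ E} [U.HasOrthogonalProjection] {e : E} (he : e ∈ U) (x : E) :
    ⟪e, U.starProjection x⟫_ℝ = ⟪e, x⟫_ℝ := by
  rw [← Submodule.inner_starProjection_left_eq_right, Submodule.starProjection_eq_self_iff.2 he]

theorem inner_add_starProjection_of_mem_orthogonal {E : Type*} [NormedAddCommGroup E]
    [InnerProductSpace ℝ E] {V : Submodule ℝ E} [Vᗮ.HasOrthogonalProjection] {e : E}
    (heV : e ∈ Vᗮ) (v : V) (x : E) : ⟪e, (v : E) + Vᗮ.starProjection x⟫_ℝ = ⟪e, x⟫_ℝ := by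
  rw [inner_add_right, Submodule.inner_left_of_mem_orthogonal v.2 heV, zero_add,
    inner_starProjection_of_mem heV]

theorem indicator_one_mem {X : Type*} (A : Set X) (x : X) :
    A.indicator (fun _ ↦ 1) x ∈ ({0, 1} : Finset ℤ) := by
  by_cases hx : x ∈ A <;> simp [hx]

section GaussianFiber

variable {E : Type*} [NormedAddCommGroup E] [InnerProductSpace ℝ E] [FiniteDimensional ℝ E]
  [MeasurableSpace E] (V : Submodule ℝ E)

/-- The law of a standard Gaussian vector given that its projection to `V` is `v`. -/
noncomputable def gaussianFiber : Kernel V E :=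
  (Kernel.id ×ₖ Kernel.const V (stdGaussian E)).map fun p ↦ (p.1 : E) + Vᗮ.starProjection p.2

/-- The conditional probability, given that the projection to `V` is `v`, of the less likely of `A`
and its complement. -/
noncomputable def minorityMass (A : Set E) (v : V) : ℝ :=
  min ((gaussianFiber V v).real A) (1 - (gaussianFiber V v).real A)

theorem minorityMass_le_half (A : Set E) (v : V) : minorityMass V A v ≤ 1 / 2 := by
  rcases le_total ((gaussianFiber V v).real A) (1 / 2) with h | h
  · exact (min_le_left _ _).trans h
  · exact (min_le_right _ _).trans (by linarith)

theorem measurable_gaussianFiber_real {A : Set E} (hA : MeasurableSet A) :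
    Measurable fun v ↦ (gaussianFiber V v).real A :=
  (Kernel.measurable_coe _ hA).ennreal_toReal

theorem measurable_minorityMass {A : Set E} (hA : MeasurableSet A) :
    Measurable (minorityMass V A) :=
  (measurable_gaussianFiber_real V hA).min
    (measurable_const.sub (measurable_gaussianFiber_real V hA))

variable [BorelSpace E]

theorem indepFun_projections_stdGaussian :
    IndepFun V.orthogonalProjectionOnto Vᗮ.starProjection (stdGaussian E) := by
  refine indepFun_stdGaussian ?_
  ext x
  have idempotent : V.starProjection (V.starProjection x) = V.starProjection x :=
    Submodule.starProjection_eq_self_iff.2 (Submodule.starProjection_apply_mem V x)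
  simp [(isSelfAdjoint_starProjection Vᗮ).adjoint_eq, idempotent]

theorem gaussianFiber_apply (v : V) :
    gaussianFiber V v = (stdGaussian E).map fun x ↦ (v : E) + Vᗮ.starProjection x := by
  rw [gaussianFiber, Kernel.map_apply _ (by fun_prop), Kernel.prod_apply, Kernel.id_apply,
    Kernel.const_apply, Measure.dirac_prod, Measure.map_map (by fun_prop) (by fun_prop)]
  rfl

instance : IsMarkovKernel (gaussianFiber V) := Kernel.IsMarkovKernel.map _ (by fun_prop)

theorem map_orthogonalProjectionOnto_prodMk :
    (stdGaussian E).map (fun x ↦ (V.orthogonalProjectionOnto x, x)) =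
      (stdGaussian E).map V.orthogonalProjectionOnto ⊗ₘ gaussianFiber V := by
  have glue : Measurable fun p : V × E ↦ (p.1, (p.1 : E) + p.2) := by fun_prop
  have glue_projections : (fun x : E ↦ (V.orthogonalProjectionOnto x, x)) =
      (fun p : V × E ↦ (p.1, (p.1 : E) + p.2)) ∘
        fun x ↦ (V.orthogonalProjectionOnto x, Vᗮ.starProjection x) := by
    ext1 x
    exact Prod.ext rfl (V.starProjection_add_starProjection_orthogonal x).symm
  rw [glue_projections, ← Measure.map_map glue (by fun_prop),
    (indepFun_iff_map_prod_eq_prod_map_map (by fun_prop) (by fun_prop)).1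
      (indepFun_projections_stdGaussian V)]
  have : IsProbabilityMeasure ((stdGaussian E).map V.orthogonalProjectionOnto) :=
    Measure.isProbabilityMeasure_map (by fun_prop)
  ext s hs
  rw [Measure.map_apply glue hs, Measure.prod_apply (glue hs), Measure.compProd_apply hs]
  refine lintegral_congr fun v ↦ ?_
  rw [gaussianFiber_apply, Measure.map_apply (by fun_prop) (measurable_prodMk_left (glue hs)),
    Measure.map_apply (by fun_prop) (measurable_prodMk_left hs)]
  rfl

theorem gaussianFiber_polyhedron_real {ι : Type*} [Countable ι] (v : V) (w : ι → E) (t : ι → ℝ) :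
    (gaussianFiber V v).real (polyhedron w t) = (stdGaussian E).real
      (polyhedron (fun i ↦ Vᗮ.starProjection (w i)) fun i ↦ t i + ⟪w i, v⟫_ℝ) := by
  rw [gaussianFiber_apply,
    map_measureReal_apply (by fun_prop) (measurableSet_polyhedron w t),
    preimage_add_starProjection_polyhedron]

variable {V} {A : Set E}

theorem hasLaw_inner_gaussianFiber {e : E} (he : ‖e‖ = 1) (heV : e ∈ Vᗮ) (v : V) :
    HasLaw (fun x ↦ ⟪e, x⟫_ℝ) (gaussianReal 0 1) (gaussianFiber V v) where
  aemeasurable := by fun_prop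
  map_eq := by
    rw [gaussianFiber_apply, Measure.map_map (by fun_prop) (by fun_prop),
      ← stdGaussian_map_inner he]
    exact congrArg (Measure.map · _)
      (funext fun x ↦ inner_add_starProjection_of_mem_orthogonal heV v x)

theorem setIntegral_comp_inner_gaussianFiber {e : E} (heV : e ∈ Vᗮ) (v : V) {ψ : ℝ → ℝ}
    (hψ : Measurable ψ) (hA : MeasurableSet A) :
    ∫ x in A, ψ ⟪e, x⟫_ℝ ∂gaussianFiber V v =
      ∫ x in (fun x ↦ (v : E) + Vᗮ.starProjection x) ⁻¹' A, ψ ⟪e, x⟫_ℝ ∂stdGaussian E := by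
  have comp_measurable : Measurable fun x : E ↦ ψ ⟪e, x⟫_ℝ := by fun_prop
  rw [gaussianFiber_apply, setIntegral_map hA comp_measurable.aestronglyMeasurable (by fun_prop)]
  simp only [inner_add_starProjection_of_mem_orthogonal heV]

theorem minorityMass_nonneg (v : V) : 0 ≤ minorityMass V A v :=
  le_min measureReal_nonneg (sub_nonneg.2 measureReal_le_one)

theorem integrable_minorityMass (hA : MeasurableSet A) (P : Measure V) [IsFiniteMeasure P] :
    Integrable (minorityMass V A) P :=
  .of_bound (measurable_minorityMass V hA).aestronglyMeasurable (1 / 2) (ae_of_all _ fun v ↦ by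
    rw [Real.norm_of_nonneg (minorityMass_nonneg v)]
    exact minorityMass_le_half V A v)

theorem exists_majority (V : Submodule ℝ E) (hA : MeasurableSet A) :
    ∃ g : V → ℤ, Measurable g ∧ (∀ v, g v ∈ ({0, 1} : Finset ℤ)) ∧
      stdGaussian E {x | g (V.orthogonalProjectionOnto x) ≠ A.indicator (fun _ ↦ 1) x} =
        ENNReal.ofReal
          (∫ v, minorityMass V A v ∂(stdGaussian E).map V.orthogonalProjectionOnto) := by
  have mass_measurable := measurable_gaussianFiber_real V hA
  set S : Set V := {v | 1 / 2 ≤ (gaussianFiber V v).real A} with hS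
  have S_measurable : MeasurableSet S := measurableSet_le measurable_const mass_measurable
  have label_measurable : Measurable (A.indicator fun _ ↦ (1 : ℤ)) := measurable_const.indicator hA
  have majority_measurable : Measurable (S.indicator fun _ ↦ (1 : ℤ)) :=
    measurable_const.indicator S_measurable
  have : IsProbabilityMeasure ((stdGaussian E).map V.orthogonalProjectionOnto) :=
    Measure.isProbabilityMeasure_map (by fun_prop)
  refine ⟨S.indicator fun _ ↦ 1, majority_measurable, indicator_one_mem S, ?_⟩
  set wrong : Set (V × E) := {p | S.indicator (fun _ ↦ (1 : ℤ)) p.1 ≠ A.indicator (fun _ ↦ 1) p.2}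
  have wrong_measurable : MeasurableSet wrong :=
    (measurableSet_eq_fun (majority_measurable.comp measurable_fst)
      (label_measurable.comp measurable_snd)).compl
  have section_mass (v : V) : gaussianFiber V v (Prod.mk v ⁻¹' wrong) =
      ENNReal.ofReal (minorityMass V A v) := by
    rw [minorityMass]
    by_cases hv : v ∈ S
    · have section_eq : Prod.mk v ⁻¹' wrong = Aᶜ := by
        ext x
        by_cases hx : x ∈ A <;> simp [wrong, hv, hx]
      rw [hS, Set.mem_ofPred_eq] at hv
      rw [section_eq, min_eq_right (by linarith), ← probReal_compl_eq_one_sub hA,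
        ofReal_measureReal]
    · have section_eq : Prod.mk v ⁻¹' wrong = A := by
        ext x
        by_cases hx : x ∈ A <;> simp [wrong, hv, hx]
      rw [hS, Set.mem_ofPred_eq] at hv
      rw [section_eq, min_eq_left (by linarith), ofReal_measureReal]
  rw [ofReal_integral_eq_lintegral_ofReal (integrable_minorityMass hA _)
      (ae_of_all _ minorityMass_nonneg), ← lintegral_congr section_mass,
    ← Measure.compProd_apply wrong_measurable, ← map_orthogonalProjectionOnto_prodMk,
    Measure.map_apply (by fun_prop) wrong_measurable]
  rfl

end GaussianFiber

section NoisyLabels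

variable {X : Type*} [MeasurableSpace X] {A : Set X}

/-- The event that the label differs from the indicator of `A` at the point. -/
def mislabeled (A : Set X) : Set (X × ℤ) := {ω | A.indicator (fun _ ↦ (1 : ℤ)) ω.1 ≠ ω.2}

theorem measurableSet_mislabeled (hA : MeasurableSet A) : MeasurableSet (mislabeled A) :=
  (measurableSet_eq_fun ((measurable_const.indicator hA).comp measurable_fst)
    measurable_snd).compl

theorem setIntegral_le_integral_mul_label {κ : Measure (X × ℤ)} {q : X → ℝ} (hA : MeasurableSet A)
    (hq : Integrable q (κ.map Prod.fst)) :
    ∫ x in A, q x ∂κ.map Prod.fst ≤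
      ∫ ω, q ω.1 * {k : ℤ | k = 1}.indicator (fun _ ↦ (1 : ℝ)) ω.2 ∂κ +
        ∫ ω in mislabeled A, |q ω.1| ∂κ := by
  have int_q : Integrable (fun ω : X × ℤ ↦ q ω.1) κ := hq.comp_measurable measurable_fst
  have int_label : Integrable
      (fun ω : X × ℤ ↦ q ω.1 * {k : ℤ | k = 1}.indicator (fun _ ↦ (1 : ℝ)) ω.2) κ :=
    integrable_mul_of_le_one int_q
      ((measurable_const.indicator (measurableSet_singleton 1)).comp measurable_snd)
      (fun _ ↦ Set.indicator_nonneg (fun _ _ ↦ zero_le_one) _)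
      fun _ ↦ Set.indicator_le' (fun _ _ ↦ le_rfl) (fun _ _ ↦ zero_le_one) _
  have wrong_measurable := measurableSet_mislabeled hA
  rw [setIntegral_map hA hq.aestronglyMeasurable (by fun_prop),
    ← integral_indicator (measurable_fst hA), ← integral_indicator wrong_measurable,
    ← integral_add int_label (int_q.abs.indicator wrong_measurable)]
  refine integral_mono (int_q.indicator (measurable_fst hA))
    (int_label.add (int_q.abs.indicator wrong_measurable)) fun ω ↦ ?_
  by_cases hω : ω ∈ mislabeled A
  · have := le_abs_self (q ω.1)
    have := neg_abs_le (q ω.1)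
    by_cases hx : ω.1 ∈ A <;> by_cases hy : ω.2 = 1 <;> simp [hω, hx, hy] <;> linarith
  · have label_eq : A.indicator (fun _ ↦ (1 : ℤ)) ω.1 = ω.2 := not_not.1 hω
    by_cases hx : ω.1 ∈ A <;> simp [hω, hx, ← label_eq]

theorem setIntegral_hermiteQuadratic_le_integral_mul_label {κ : Measure (X × ℤ)} {s : X → ℝ}
    (hs : HasLaw s (gaussianReal 0 1) (κ.map Prod.fst)) (hA : MeasurableSet A) {ζ : ℝ}
    (hζ : 0 < ζ) (hζ1 : ζ ≤ 1) (a b : ℝ) :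
    ∫ x in A, hermiteQuadratic a b (s x) ∂κ.map Prod.fst ≤
      ∫ ω, hermiteQuadratic a b (s ω.1) * {k : ℤ | k = 1}.indicator (fun _ ↦ (1 : ℝ)) ω.2 ∂κ +
        8 * (|a| / √(Real.log (1 / ζ + 1)) + |b|) * noiseLevel ζ (κ.real (mislabeled A)) := by
  have int_q : Integrable (fun x ↦ hermiteQuadratic a b (s x)) (κ.map Prod.fst) :=
    (hs.map_eq ▸ integrable_hermiteQuadratic a b).comp_aemeasurable hs.aemeasurable
  have law : HasLaw (fun ω : X × ℤ ↦ s ω.1) (gaussianReal 0 1) κ :=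
    hs.comp ⟨by fun_prop, rfl⟩
  exact (setIntegral_le_integral_mul_label hA int_q).trans
    (add_le_add_right (setIntegral_abs_hermiteQuadratic_le law _ hζ hζ1 a b) _)

end NoisyLabels

section ConditionalLaw

variable {d : ℕ} (D : Measure (RSpace d × ℤ)) (V : Submodule ℝ (RSpace d))

theorem map_orthogonalProjectionOnto_fst {𝒴 : Finset ℤ} (hD : IsLabeledGaussian 𝒴 D) :
    D.map (fun ω ↦ V.orthogonalProjectionOnto ω.1) =
      (stdGaussian (RSpace d)).map V.orthogonalProjectionOnto := by
  rw [← hD.marginal, Measure.map_map (by fun_prop) (by fun_prop)]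
  rfl

variable [IsProbabilityMeasure D]

instance : IsMarkovKernel (condOnProj D V) := by
  unfold condOnProj
  infer_instance

variable {D} {𝒴 : Finset ℤ}

theorem condOnProj_map_fst (hD : IsLabeledGaussian 𝒴 D) :
    ∀ᵐ v ∂(stdGaussian (RSpace d)).map V.orthogonalProjectionOnto,
      (condOnProj D V v).map Prod.fst = gaussianFiber V v := by
  have of_map := condDistrib_comp (μ := D) (mβ := inferInstance)
    (fun ω ↦ V.orthogonalProjectionOnto ω.1) (Y := fun ω : RSpace d × ℤ ↦ ω) (by fun_prop)
    (f := Prod.fst) measurable_fst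
  have of_disintegration : condDistrib (Prod.fst ∘ fun ω : RSpace d × ℤ ↦ ω)
      (fun ω ↦ V.orthogonalProjectionOnto ω.1) D
        =ᵐ[D.map fun ω ↦ V.orthogonalProjectionOnto ω.1] gaussianFiber V := by
    refine condDistrib_ae_eq_of_measure_eq_compProd_of_measurable (by fun_prop) (by fun_prop) ?_
    rw [map_orthogonalProjectionOnto_fst D V hD, ← map_orthogonalProjectionOnto_prodMk,
      ← hD.marginal, Measure.map_map (by fun_prop) (by fun_prop)]
    rfl
  rw [map_orthogonalProjectionOnto_fst D V hD] at of_map of_disintegration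
  filter_upwards [of_map, of_disintegration] with v map_eq fiber_eq
  rw [← fiber_eq, map_eq, Kernel.map_apply _ measurable_fst]
  rfl

theorem lintegral_condOnProj (hD : IsLabeledGaussian 𝒴 D) {S : Set (RSpace d × ℤ)}
    (hS : MeasurableSet S) :
    ∫⁻ v, condOnProj D V v S ∂(stdGaussian (RSpace d)).map V.orthogonalProjectionOnto = D S := by
  rw [← map_orthogonalProjectionOnto_fst D V hD, ← Measure.bind_apply hS (Kernel.aemeasurable _)]
  unfold condOnProj
  rw [condDistrib_comp_map (by fun_prop) (by fun_prop)]
  simp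

theorem measurable_condOnProj_real {S : Set (RSpace d × ℤ)} (hS : MeasurableSet S) :
    Measurable fun v ↦ (condOnProj D V v).real S :=
  (Kernel.measurable_coe _ hS).ennreal_toReal

theorem integrable_condOnProj_real {S : Set (RSpace d × ℤ)} (hS : MeasurableSet S) (P : Measure V)
    [IsFiniteMeasure P] : Integrable (fun v ↦ (condOnProj D V v).real S) P :=
  .of_bound (measurable_condOnProj_real V hS).aestronglyMeasurable 1 (ae_of_all _ fun v ↦ by
    rw [Real.norm_of_nonneg measureReal_nonneg]
    exact measureReal_le_one)

theorem integral_condOnProj_real_le (hD : IsLabeledGaussian 𝒴 D) {S : Set (RSpace d × ℤ)}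
    (hS : MeasurableSet S) {ζ : ℝ} (hζ : 0 ≤ ζ) (hDζ : D S ≤ ENNReal.ofReal ζ) :
    ∫ v, (condOnProj D V v).real S ∂(stdGaussian (RSpace d)).map V.orthogonalProjectionOnto ≤
      ζ := by
  rw [integral_eq_lintegral_of_nonneg_ae (ae_of_all _ fun v ↦ measureReal_nonneg)
    (measurable_condOnProj_real V hS).aestronglyMeasurable]
  refine ENNReal.toReal_le_of_le_ofReal hζ ?_
  rwa [lintegral_congr fun v ↦ ofReal_measureReal, lintegral_condOnProj V hD hS]

end ConditionalLaw

section Moment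

variable {d : ℕ}

theorem isPolynomialOn_hermiteQuadratic (U : Submodule ℝ (RSpace d)) (e : RSpace d) (a b : ℝ) :
    IsPolynomialOn U 2 fun u ↦ hermiteQuadratic a b ⟪e, u⟫_ℝ := by
  set l : MvPolynomial (Fin d) ℝ := ∑ j, MvPolynomial.C (e j) * MvPolynomial.X j with hl
  have degree_l : l.totalDegree ≤ 1 :=
    MvPolynomial.totalDegree_finsetSum_le fun j _ ↦
      (MvPolynomial.totalDegree_mul _ _).trans (by simp)
  have eval_l (u : U) : MvPolynomial.eval (fun i ↦ (u : RSpace d) i) l = ⟪e, u⟫_ℝ := by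
    simp [hl, PiLp.inner_apply, mul_comm]
  refine ⟨MvPolynomial.C a * l + MvPolynomial.C b * (MvPolynomial.C 1 - l ^ 2), ?_,
    fun u ↦ by simp [eval_l, hermiteQuadratic]⟩
  have degree_linear := MvPolynomial.totalDegree_mul (MvPolynomial.C a) l
  have degree_square := MvPolynomial.totalDegree_pow l 2
  have degree_sub := MvPolynomial.totalDegree_sub (MvPolynomial.C (σ := Fin d) (1 : ℝ)) (l ^ 2)
  have degree_quadratic :=
    MvPolynomial.totalDegree_mul (MvPolynomial.C b) (MvPolynomial.C 1 - l ^ 2)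
  rw [MvPolynomial.totalDegree_C] at degree_linear degree_sub degree_quadratic
  exact (MvPolynomial.totalDegree_add _ _).trans (max_le (by omega) (by omega))

theorem HasMoment.mono {𝒴 : Finset ℤ} {m : ℕ} {σ σ' : ℝ} {D : Measure (RSpace d × ℤ)}
    [IsProbabilityMeasure D] {V U : Submodule ℝ (RSpace d)} {x₀ : RSpace d}
    (h : HasMoment 𝒴 m σ D V U x₀) (hσ : σ' ≤ σ) : HasMoment 𝒴 m σ' D V U x₀ := by
  obtain ⟨p, polynomial, z, hz, mean_zero, lt⟩ := h
  exact ⟨p, polynomial, z, hz, mean_zero, lt.trans_le' (by gcongr)⟩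

theorem sqrt_integral_hermiteQuadratic_sq_le {a b : ℝ} (hab : a ^ 2 + 2 * b ^ 2 ≤ 4) :
    √(∫ s, hermiteQuadratic a b s ^ 2 ∂(gaussianReal 0 1)) ≤ 2 := by
  rw [integral_hermiteQuadratic_sq]
  exact Real.sqrt_le_iff.2 ⟨by norm_num, by linarith⟩

theorem hasMoment_of_hermiteQuadratic {D : Measure (RSpace d × ℤ)} [IsProbabilityMeasure D]
    {V U : Submodule ℝ (RSpace d)} {x₀ e : RSpace d} (he : ‖e‖ = 1) (heU : e ∈ U) {a b σ : ℝ}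
    (hab : a ^ 2 + 2 * b ^ 2 ≤ 4) (hσ : 0 ≤ σ)
    (h : σ * 2 < ∫ ω, hermiteQuadratic a b ⟪e, ω.1⟫_ℝ *
      {k : ℤ | k = 1}.indicator (fun _ ↦ (1 : ℝ)) ω.2
        ∂condOnProj D V (V.orthogonalProjectionOnto x₀)) :
    HasMoment {0, 1} 2 σ D V U x₀ := by
  have inner_projection (x : RSpace d) : ⟪e, (U.orthogonalProjectionOnto x : RSpace d)⟫_ℝ =
      ⟪e, x⟫_ℝ := inner_starProjection_of_mem heU x
  refine ⟨fun u ↦ hermiteQuadratic a b ⟪e, u⟫_ℝ, isPolynomialOn_hermiteQuadratic U e a b, 1,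
    by simp, ?_, ?_⟩ <;> simp only [inner_projection]
  · exact (integral_comp_inner_stdGaussian he (measurable_hermiteQuadratic a b)).trans
      (integral_hermiteQuadratic a b)
  · rw [integral_comp_inner_stdGaussian he ((measurable_hermiteQuadratic a b).pow_const 2)]
    exact h.trans_le' (by gcongr; exact sqrt_integral_hermiteQuadratic_sq_le hab)

theorem normalize_starProjection_mem {V W : Submodule ℝ (RSpace d)} {w : RSpace d} (hw : w ∈ W) :
    ‖Vᗮ.starProjection w‖⁻¹ • Vᗮ.starProjection w ∈ (V ⊔ W) ⊓ Vᗮ := by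
  refine Submodule.smul_mem _ _ ⟨?_, Submodule.starProjection_apply_mem _ _⟩
  rw [Submodule.starProjection_orthogonal_val]
  exact Submodule.sub_mem _ (Submodule.mem_sup_right hw)
    (Submodule.mem_sup_left (Submodule.starProjection_apply_mem _ _))

theorem exists_hasMoment_of_lt_minorityMass : ∃ C c : ℝ, 1 ≤ C ∧ 0 < c ∧ c ≤ 1 ∧ ∀ (d : ℕ)
    (ι : Type*) [Fintype ι] (w : ι → RSpace d) (t : ι → ℝ) (D : Measure (RSpace d × ℤ))
    [IsProbabilityMeasure D] (V : Submodule ℝ (RSpace d)) (x₀ : RSpace d) (ζ ε : ℝ),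
    0 < ζ → ζ ≤ 1 → 0 ≤ ε →
      (condOnProj D V (V.orthogonalProjectionOnto x₀)).map Prod.fst =
        gaussianFiber V (V.orthogonalProjectionOnto x₀) →
      C * Fintype.card ι * noiseLevel ζ ((condOnProj D V (V.orthogonalProjectionOnto x₀)).real
          (mislabeled (polyhedron w t))) + ε <
        minorityMass V (polyhedron w t) (V.orthogonalProjectionOnto x₀) →
      HasMoment {0, 1} 2 (c / 2 * (ε / Fintype.card ι) * √ζ) D V
        ((V ⊔ Submodule.span ℝ (Set.range w)) ⊓ Vᗮ) x₀ := by
  obtain ⟨C, c, hC, hc, hc1, correlation⟩ := exists_quadratic_correlation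
  refine ⟨C, c, hC, hc, hc1, fun d ι _ w t D _ V x₀ ζ ε hζ hζ1 hε marginal gap ↦ ?_⟩
  set v := V.orthogonalProjectionOnto x₀
  rw [minorityMass, gaussianFiber_polyhedron_real] at gap
  obtain ⟨i, normal_ne, a, b, hab, correlated⟩ :=
    correlation _ ι _ _ ζ _ ε hζ hζ1 measureReal_nonneg hε gap
  have e_norm : ‖‖Vᗮ.starProjection (w i)‖⁻¹ • Vᗮ.starProjection (w i)‖ = 1 :=
    norm_smul_inv_norm (𝕜 := ℝ) normal_ne
  have e_mem := normalize_starProjection_mem (V := V) (Submodule.subset_span ⟨i, rfl⟩ :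
    w i ∈ Submodule.span ℝ (Set.range w))
  refine hasMoment_of_hermiteQuadratic e_norm e_mem hab (by positivity) ?_
  have hA := measurableSet_polyhedron w t
  rw [← preimage_add_starProjection_polyhedron,
    ← setIntegral_comp_inner_gaussianFiber e_mem.2 v (measurable_hermiteQuadratic a b) hA]
    at correlated
  have law := hasLaw_inner_gaussianFiber e_norm e_mem.2 v
  rw [← marginal] at correlated law
  linarith [setIntegral_hermiteQuadratic_le_integral_mul_label law hA hζ hζ1 a b]

end Moment

section NoisyFibers

theorem ofReal_le_measure_lt_of_le_integral {Ω : Type*} [MeasurableSpace Ω] {P : Measure Ω}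
    [IsProbabilityMeasure P] {h : Ω → ℝ} (hm : Measurable h) (hi : Integrable h P) {M δ ε : ℝ}
    (hM : 0 < M) (hδ : 0 ≤ δ) (h_le : ∀ ω, h ω ≤ M) (mean_ge : δ + M * ε ≤ ∫ ω, h ω ∂P) :
    ENNReal.ofReal ε ≤ P {ω | δ < h ω} := by
  set G := {ω | δ < h ω}
  have hG : MeasurableSet G := measurableSet_lt measurable_const hm
  have integrable_bound : Integrable (G.indicator fun _ ↦ M) P := (integrable_const M).indicator hG
  have integral_le : ∫ ω, h ω ∂P ≤ ∫ ω, (δ + G.indicator (fun _ ↦ M) ω) ∂P := by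
    refine integral_mono hi ((integrable_const δ).add integrable_bound) fun ω ↦ ?_
    by_cases hω : ω ∈ G
    · simpa only [Set.indicator_of_mem hω] using (h_le ω).trans (le_add_of_nonneg_left hδ)
    · simpa only [Set.indicator_of_notMem hω, add_zero] using not_lt.1 hω
  rw [integral_add (integrable_const δ) integrable_bound, integral_indicator_const _ hG,
    integral_const, probReal_univ, one_smul, smul_eq_mul] at integral_le
  rw [← ofReal_measureReal (μ := P) (s := G)]
  exact ENNReal.ofReal_le_ofReal (le_of_mul_le_mul_left (by linarith) hM)

theorem ofReal_le_measure_lt_minorityMass {d : ℕ} {D : Measure (RSpace d × ℤ)}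
    [IsProbabilityMeasure D] {𝒴 : Finset ℤ} (hD : IsLabeledGaussian 𝒴 D)
    (V : Submodule ℝ (RSpace d)) {A : Set (RSpace d)} (hA : MeasurableSet A) {ζ ζ' ε M : ℝ}
    (hζ : 0 ≤ ζ) (hDζ : D (mislabeled A) ≤ ENNReal.ofReal ζ) (hζ' : 0 < ζ') (hζ'1 : ζ' ≤ 1)
    (hε : 0 ≤ ε) (hM : 0 ≤ M)
    (mean_gt : M * noiseLevel ζ' ζ + 3 * ε / 4 <
      ∫ v, minorityMass V A v ∂(stdGaussian (RSpace d)).map V.orthogonalProjectionOnto) :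
    ENNReal.ofReal ε ≤ stdGaussian (RSpace d) {x₀ |
      M * noiseLevel ζ' ((condOnProj D V (V.orthogonalProjectionOnto x₀)).real (mislabeled A)) +
        ε / 4 < minorityMass V A (V.orthogonalProjectionOnto x₀)} := by
  set P := (stdGaussian (RSpace d)).map V.orthogonalProjectionOnto with hP
  set z : V → ℝ := fun v ↦ (condOnProj D V v).real (mislabeled A)
  have : IsProbabilityMeasure P := Measure.isProbabilityMeasure_map (by fun_prop)
  have wrong_measurable := measurableSet_mislabeled hA
  have z_measurable : Measurable z := measurable_condOnProj_real V wrong_measurable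
  have z_integrable : Integrable z P := integrable_condOnProj_real V wrong_measurable P
  have noise_measurable : Measurable fun v ↦ M * noiseLevel ζ' (z v) := by
    unfold noiseLevel
    fun_prop
  have noise_integrable : Integrable (fun v ↦ M * noiseLevel ζ' (z v)) P :=
    ((z_integrable.const_mul _).add (integrable_const ζ')).const_mul M
  have noise_integral_le : ∫ v, M * noiseLevel ζ' (z v) ∂P ≤ M * noiseLevel ζ' ζ := by
    have := two_thirds_le_log_one_div_add_one hζ' hζ'1
    simp only [noiseLevel]
    rw [integral_const_mul, integral_add (z_integrable.const_mul _) (integrable_const ζ'),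
      integral_const_mul, integral_const, probReal_univ, one_smul]
    gcongr
    exact integral_condOnProj_real_le V hD wrong_measurable hζ hDζ
  have excess_measurable := (measurable_minorityMass V hA).sub noise_measurable
  have excess_large := ofReal_le_measure_lt_of_le_integral (P := P) (M := 1 / 2) (δ := ε / 4)
    (ε := ε) excess_measurable ((integrable_minorityMass hA P).sub noise_integrable) (by norm_num)
    (by positivity)
    (fun v ↦ (sub_le_self _ (mul_nonneg hM (noiseLevel_pos hζ' hζ'1 measureReal_nonneg).le)).trans
      (minorityMass_le_half V A v))
    (by
      simp only [Pi.sub_apply]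
      rw [integral_sub (integrable_minorityMass hA P) noise_integrable]
      linarith)
  rw [hP, Measure.map_apply (by fun_prop) (measurableSet_lt measurable_const excess_measurable)]
    at excess_large
  simpa only [Set.preimage_ofPred_eq, Pi.sub_apply, lt_sub_iff_add_lt'] using excess_large

end NoisyFibers

theorem mul_noiseLevel_max_le {ζ ε M : ℝ} (hζ : 0 < ζ) (hζ1 : ζ ≤ 1) (hε : 0 < ε) (hε1 : ε ≤ 1)
    (hM : 1 ≤ M) :
    M * noiseLevel (max ζ ((ε / (20 * M)) ^ 2)) ζ ≤
      5 / 2 * M * (ζ * Real.log (1 / ζ + 1)) + ε / 4 := by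
  have ratio_le_one : ε / (20 * M) ≤ 1 := (div_le_one (by positivity)).2 (by linarith)
  calc M * noiseLevel (max ζ ((ε / (20 * M)) ^ 2)) ζ
      ≤ M * (5 / 2 * (ζ * Real.log (1 / ζ + 1)) + 5 * (ε / (20 * M))) := by
        gcongr
        exact noiseLevel_max_le hζ hζ1 (by positivity) ratio_le_one
    _ = 5 / 2 * M * (ζ * Real.log (1 / ζ + 1)) + ε / 4 := by
        field_simp
        ring

theorem exists_classifier_or_hasMoment : ∃ C c : ℝ, 0 < C ∧ 0 < c ∧ c < 1 ∧ ∀ (d : ℕ)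
    (ι : Type*) [Fintype ι] [Nonempty ι] (w : ι → RSpace d) (t : ι → ℝ)
    (D : Measure (RSpace d × ℤ)) [IsProbabilityMeasure D] (𝒴 : Finset ℤ)
    (V : Submodule ℝ (RSpace d)) (ζ ε : ℝ), 0 < ζ → ζ ≤ 1 → 0 < ε → ε ≤ 1 →
      IsLabeledGaussian 𝒴 D → D (mislabeled (polyhedron w t)) ≤ ENNReal.ofReal ζ →
      (∃ g : V → ℤ, Measurable g ∧ (∀ v, g v ∈ ({0, 1} : Finset ℤ)) ∧
        stdGaussian (RSpace d) {x | g (V.orthogonalProjectionOnto x) ≠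
            (polyhedron w t).indicator (fun _ ↦ 1) x} ≤
          ENNReal.ofReal (C * Fintype.card ι * (ζ * Real.log (1 / ζ + 1)) + ε)) ∨
      ENNReal.ofReal ε ≤ stdGaussian (RSpace d) {x₀ | HasMoment {0, 1} 2
        (c * (ε / Fintype.card ι) ^ 2) D V
          ((V ⊔ Submodule.span ℝ (Set.range w)) ⊓ Vᗮ) x₀} := by
  obtain ⟨C, c, hC, hc, hc1, moment⟩ := exists_hasMoment_of_lt_minorityMass
  refine ⟨5 / 2 * C, c / (160 * C), by positivity, by positivity,
    (div_lt_one (by positivity)).2 (by linarith),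
    fun d ι _ _ w t D _ 𝒴 V ζ ε hζ hζ1 hε hε1 hD hDζ ↦ or_iff_not_imp_left.2 fun no_g ↦ ?_⟩
  set K := (Fintype.card ι : ℝ)
  have K_ge : 1 ≤ K := Nat.one_le_cast.2 Fintype.card_pos
  have hA := measurableSet_polyhedron w t
  obtain ⟨g, g_measurable, g_mem, g_error⟩ := exists_majority V hA
  have mean_gt : 5 / 2 * C * K * (ζ * Real.log (1 / ζ + 1)) + ε <
      ∫ v, minorityMass V (polyhedron w t) v
        ∂(stdGaussian (RSpace d)).map V.orthogonalProjectionOnto := by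
    by_contra mean_le
    exact no_g ⟨g, g_measurable, g_mem,
      g_error.trans_le (ENNReal.ofReal_le_ofReal (not_lt.1 mean_le))⟩
  set r := ε / (20 * (C * K)) with hr
  have r_pos : 0 < r := by positivity
  have CK_ge : 1 ≤ C * K := one_le_mul_of_one_le_of_one_le hC K_ge
  have r_le_one : r ≤ 1 := (div_le_one (by positivity)).2 (by linarith)
  have cutoff_pos : 0 < max ζ (r ^ 2) := lt_max_of_lt_left hζ
  have cutoff_le_one : max ζ (r ^ 2) ≤ 1 := max_le hζ1 (pow_le_one₀ r_pos.le r_le_one)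
  have noise_le := mul_noiseLevel_max_le hζ hζ1 hε hε1 CK_ge
  refine (ofReal_le_measure_lt_minorityMass hD V hA hζ.le hDζ cutoff_pos cutoff_le_one hε.le
    (by positivity : 0 ≤ C * K) (by linarith only [noise_le, mean_gt])).trans (measure_mono_ae ?_)
  filter_upwards [ae_of_ae_map (by fun_prop) (condOnProj_map_fst V hD)] with x₀ marginal gap
  refine (moment d ι w t D V x₀ _ (ε / 4) cutoff_pos cutoff_le_one (by positivity) marginal
    gap).mono ?_
  calc c / (160 * C) * (ε / K) ^ 2 = c / 2 * (ε / 4 / K) * r := by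
        rw [hr]
        field_simp
        norm_num
    _ ≤ c / 2 * (ε / 4 / K) * √(max ζ (r ^ 2)) := by
        gcongr
        exact Real.le_sqrt_of_sq_le (le_max_right _ _)

section Halfspaces

variable {d : ℕ}

theorem multiclassSurfaceArea_indicator (A : Set (RSpace d)) :
    multiclassSurfaceArea {0, 1} (A.indicator fun _ ↦ 1) =
      gaussianSurfaceArea Aᶜ + gaussianSurfaceArea A := by
  have level_zero : {x | A.indicator (fun _ ↦ (1 : ℤ)) x = 0} = Aᶜ := by
    ext x
    by_cases hx : x ∈ A <;> simp [hx]
  have level_one : {x | A.indicator (fun _ ↦ (1 : ℤ)) x = 1} = A := by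
    ext x
    by_cases hx : x ∈ A <;> simp [hx]
  rw [multiclassSurfaceArea, Finset.sum_pair (by norm_num), level_zero, level_one]

theorem multiclassSurfaceArea_polyhedron_le {K : ℕ} (hK : 0 < K) (w : Fin K → RSpace d)
    (t : Fin K → ℝ) :
    multiclassSurfaceArea {0, 1} ((polyhedron w t).indicator fun _ ↦ 1) ≤
      ENNReal.ofReal (2 * (Real.exp 7 + 2) * √(Real.log (K + 1))) := by
  obtain ⟨area_le, area_compl_le⟩ := gaussianSurfaceArea_polyhedron_le hK w t
  rw [multiclassSurfaceArea_indicator]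
  refine (add_le_add area_compl_le area_le).trans_eq ?_
  rw [← ENNReal.ofReal_add (by positivity) (by positivity), mul_assoc 2, two_mul]

theorem indicator_polyhedron_orthogonalProjectionOnto {ι : Type*} (w : ι → RSpace d) (t : ι → ℝ)
    (x : RSpace d) :
    (polyhedron w t).indicator (fun _ ↦ (1 : ℤ)) x = (polyhedron w t).indicator (fun _ ↦ 1)
      ((Submodule.span ℝ (Set.range w)).orthogonalProjectionOnto x : RSpace d) := by
  have inner_eq (i : ι) :
      ⟪w i, ((Submodule.span ℝ (Set.range w)).orthogonalProjectionOnto x : RSpace d)⟫_ℝ =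
        ⟪w i, x⟫_ℝ :=
    inner_starProjection_of_mem (Submodule.subset_span (Set.mem_range_self i)) x
  classical simp only [Set.indicator_apply, polyhedron, Set.mem_ofPred_eq, inner_eq]

end Halfspaces

theorem proposition4p2 :
    ∃ (C c : ℝ) (q : ℕ), 0 < C ∧ 0 < c ∧ c < 1 ∧
      ∀ (d K : ℕ) (ζ ε : ℝ), 0 < d → 0 < K → 0 < ζ → ζ < 1 → 0 < ε → ε < 1 →
        IsWellBehaved ({0, 1} : Finset ℤ) (intersectionsOfHalfspaces K d) 2 ζ ε K
          (C * K * (ζ * Real.log (1 / ζ + 1)) + ε)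
          (c * (ε / K) ^ q)
          (C * √(Real.log (K + 1))) := by
  obtain ⟨C, c, hC, hc, hc1, dichotomy⟩ := exists_classifier_or_hasMoment
  refine ⟨max C (2 * (Real.exp 7 + 2)), c, 2, lt_max_of_lt_left hC, hc, hc1, ?_⟩
  rintro d K ζ ε - hK hζ hζ1 hε hε1 f ⟨w, t, hf⟩
  obtain rfl : f = (polyhedron w t).indicator fun _ ↦ 1 := hf
  have : Nonempty (Fin K) := ⟨⟨0, hK⟩⟩
  have log_nonneg : 0 ≤ Real.log (1 / ζ + 1) := Real.log_nonneg (by simp [hζ.le])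
  refine ⟨measurable_const.indicator (measurableSet_polyhedron w t),
    indicator_one_mem _, (multiclassSurfaceArea_polyhedron_le hK w t).trans ?_,
    Submodule.span ℝ (Set.range w), ?_,
    indicator_polyhedron_orthogonalProjectionOnto w t, fun D _ hD hDζ V ↦ ?_⟩
  · gcongr
    exact le_max_right _ _
  · simpa [Set.finrank] using finrank_range_le_card (R := ℝ) w
  · have := dichotomy d (Fin K) w t D _ V ζ ε hζ hζ1.le hε hε1.le hD hDζ
    rw [Fintype.card_fin] at this
    refine this.imp_left fun ⟨g, g_measurable, g_mem, error_le⟩ ↦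
      ⟨g, g_measurable, g_mem, error_le.trans ?_⟩
    gcongr
    exact le_max_left _ _
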